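/- **Theorem 3.5.** Let the broom be $\mathcal B=A\cup B\subset\mathbb R^2$, where $A$ is the union of the segments joining $a_0=(-1,1)$ to $v=(0,0)$ and to the points $a_n=(-\tfrac1n,0)$, $n\ge 1$, and $B$ is the union of the segments joining $b_0=(1,1)$ to $v$ and to the points $b_n=(\tfrac1n,0)$, $n\ge1$; the point $v$ is called its center. A *hairy disk* $\mathcal H\subset\mathbb R^2$ is the union of the closed unit disk $D^2$ and of topologically embedded copies $\mathcal B_i\subset\mathbb R^2$ ($i\ge 1$) of $\mathcal B$ such that, if $m_i$ denotes the image in $\mathcal B_i$ of the center, then $\mathcal B_i\cap D^2=\{m_i\}\subset\partial D^2$, the set $\{m_i\}_{i\ge 1}$ is dense in $\partial D^2$, the $\mathcal B_i$ are pairwise disjoint, and $\operatorname{diam}\mathcal B_i\to 0$. Hairy disks exist. Given a hairy disk $\mathcal H$, put $c(k)=(-\tfrac1k,0,0)$ for $k\ge1$, and let $\mathcal H(k)\subset\mathbb R^3$ be the copy of $\mathcal H$, scaled to have diameter $\tfrac1k$, that lies in the plane $x=-\tfrac1k$ with the center of its disk at $c(k)$. Let $$\mathcal{WH}^\circ=\bigcup_{k\ge1}\mathcal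 H(k)\cup\bigcup_{k\ge1}[c(k),c(k+1)],\qquad \mathcal{WBH}^\circ=\mathcal B'\cup[b,c(1)]\cup\mathcal{WH}^\circ,$$ where $\mathcal B'$ is a copy of $\mathcal B$ in the plane $x=-2$ with center $b=(-2,0,0)$, and let $$\mathcal{WH}=\mathcal{WH}^\circ\cup\{(0,0,0)\},\qquad \mathcal{WBH}=\mathcal{WBH}^\circ\cup\{(0,0,0)\},$$ all with the subspace topology of $\mathbb R^3$. Two spaces $X,Y$ are called *$h$-equal* if each homotopy dominates the other, i.e. there are maps $f:X\to Y$, $g:Y\to X$ with $g\circ f\simeq\mathrm{id}_X$, and maps $f':Y\to X$, $g':X\to Y$ with $g'\circ f'\simeq\mathrm{id}_Y$. Then, for every hairy disk $\mathcal H$: 1. $\mathcal{WH}^\circ$ and $\mathcal{WBH}^\circ$ are $h$-equal but not homotopy equivalent. 2. $\mathcal{WH}$ and $\mathcal{WBH}$ are $h$-equal but not homotopy equivalent. 3. $\mathcal{WH}$ and $\mathcal{WBH}$ are homeomorphic to the one-point compactifications of $\mathcal{WH}^\circ$ and $\mathcal{WBH}^\circ$, respectively. 4. $\mathcal{WH}$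 and $\mathcal{WBH}$ are 2-dimensional continua, i.e. compact connected metrizable spaces of (small inductive) dimension $2$. -/

import Mathlib

open Set Topology Filter

noncomputable section

/-! ### Homotopy domination and `h`-equality -/

/-- `X` is homotopy dominated by `Y`: there are maps `f : X → Y`, `g : Y → X` with `g ∘ f ≃ id_X`. -/
def HomotopyDominated (X Y : Type) [TopologicalSpace X] [TopologicalSpace Y] : Prop :=
  ∃ (f : C(X, Y)) (g : C(Y, X)), (g.comp f).Homotopic (ContinuousMap.id X)

/-- `X` and `Y` are `h`-equal: each of them homotopy dominates the other. -/
def HEqual (X Y : Type) [TopologicalSpace X] [TopologicalSpace Y] : Prop :=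
  HomotopyDominated X Y ∧ HomotopyDominated Y X

/-- `X` and `Y` are homotopy equivalent. -/
def HomotopyEquivalent (X Y : Type) [TopologicalSpace X] [TopologicalSpace Y] : Prop :=
  Nonempty (ContinuousMap.HomotopyEquiv X Y)

/-! ### The double broom -/

/-- The Euclidean plane. -/
abbrev Plane : Type := EuclideanSpace ℝ (Fin 2)

/-- Euclidean three-space. -/
abbrev Space : Type := EuclideanSpace ℝ (Fin 3)

/-- The left half of the broom: the segments joining the apex `a₀ = (-1, 1)` to the center
`v = (0, 0)` and to the endpoints `aₙ = (-1/n, 0)`, `n ≥ 1`, which converge to `v`. -/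
def broomLeft : Set Plane :=
  segment ℝ (0 : Plane) !₂[-1, 1] ∪
    ⋃ n : ℕ, segment ℝ (!₂[-(1 / ((n : ℝ) + 1)), 0] : Plane) !₂[-1, 1]

/-- The right half of the broom: the segments joining the apex `b₀ = (1, 1)` to the center
`v = (0, 0)` and to the endpoints `bₙ = (1/n, 0)`, `n ≥ 1`, which converge to `v`. -/
def broomRight : Set Plane :=
  segment ℝ (0 : Plane) !₂[1, 1] ∪
    ⋃ n : ℕ, segment ℝ (!₂[1 / ((n : ℝ) + 1), 0] : Plane) !₂[1, 1]

/-- The (double) topological broom. Its two halves meet only in the center point. -/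
def broom : Set Plane := broomLeft ∪ broomRight

theorem zero_mem_broom : (0 : Plane) ∈ broom :=
  Or.inl (Or.inl (left_mem_segment ℝ _ _))

/-- The center point `v` of the broom. -/
def broomCenter : broom := ⟨0, zero_mem_broom⟩

/-! ### Hairy disks -/

/-- The choices made in the construction of a hairy disk: a sequence of points `m i` dense in the
boundary of the unit disk `D²` of the plane and, for every `i`, a copy of the broom in the plane
(the range of an embedding `hair i`) that is attached to the disk at `m i` by its center and meets
the disk nowhere else; the copies are pairwise disjoint and their diameters tend to zero. -/
structure HairyDisk where
  m : ℕ → Plane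
  norm_m : ∀ i, ‖m i‖ = 1
  dense_m : Metric.sphere (0 : Plane) 1 ⊆ closure (range m)
  hair : ℕ → broom → Plane
  isEmbedding_hair : ∀ i, IsEmbedding (hair i)
  hair_center : ∀ i, hair i broomCenter = m i
  hair_inter_disk : ∀ i, range (hair i) ∩ Metric.closedBall (0 : Plane) 1 = {m i}
  disjoint_hair : ∀ i j, i ≠ j → Disjoint (range (hair i)) (range (hair j))
  tendsto_diam_hair : Tendsto (fun i => Metric.diam (range (hair i))) atTop (𝓝 0)

/-- The plane of `ℝ³` parallel to the `yz`-plane through `(x, 0, 0)`. -/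
def slice (x : ℝ) (p : Plane) : Space := !₂[x, p 0, p 1]

/-- The center of the `k`-th factor, `k = 0, 1, 2, …`, of the infinite wedges: `(-1/(k+1), 0, 0)`.
(The factors are numbered from `0`.) -/
def wedgePoint (k : ℕ) : Space := slice (-(1 / ((k : ℝ) + 1))) 0

namespace HairyDisk

/-- The hairy disk itself, as a subset of the plane. -/
def carrier (H : HairyDisk) : Set Plane :=
  Metric.closedBall (0 : Plane) 1 ∪ ⋃ i, range (H.hair i)

/-- The `k`-th factor, `k = 0, 1, 2, …`: the copy of the hairy disk, scaled to have diameter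
`1/(k+1)`, in the plane `x = -1/(k+1)`, with the center of its disk at `wedgePoint k`. -/
def factor (H : HairyDisk) (k : ℕ) : Set Space :=
  (fun p : Plane =>
    slice (-(1 / ((k : ℝ) + 1))) ((1 / (((k : ℝ) + 1) * Metric.diam H.carrier)) • p)) '' H.carrier

/-- The noncompact wedge of hairy disks, consecutive factors being joined by the segments between
their centers. -/
def WHo (H : HairyDisk) : Set Space :=
  (⋃ k, H.factor k) ∪ ⋃ k, segment ℝ (wedgePoint k) (wedgePoint (k + 1))

/-- The noncompact wedge of hairy disks with one extra broom, placed in the plane `x = -2`, whose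
center `(-2, 0, 0)` is joined by a segment to the center of the first hairy disk. -/
def WBHo (H : HairyDisk) : Set Space :=
  slice (-2) '' broom ∪ segment ℝ (slice (-2) 0) (wedgePoint 0) ∪ H.WHo

/-- `WHo` together with the origin of `ℝ³`. -/
def WH (H : HairyDisk) : Set Space := H.WHo ∪ {0}

/-- `WBHo` together with the origin of `ℝ³`. -/
def WBH (H : HairyDisk) : Set Space := H.WBHo ∪ {0}

end HairyDisk

/-- A two-dimensional continuum: a compact connected metrizable space of dimension two.
(For such spaces the inductive dimensions and the covering dimension coincide.) -/
def IsTwoDimContinuum (X : Type) [TopologicalSpace X] : Prop :=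
  CompactSpace X ∧ ConnectedSpace X ∧ TopologicalSpace.MetrizableSpace X ∧
    smallInductiveDimension X = 2

/-! ### Hairy disks exist -/

/-- The map that places a broom at a point `m` of the unit circle. -/
def placeBroom (m : Plane) (s : ℝ) (p : Plane) : Plane :=
  !₂[m 0 * (1 + s * (p 1 + |p 0|)) - s * p 0 * m 1, m 1 * (1 + s * (p 1 + |p 0|)) + s * p 0 * m 0]

theorem broom_bounds {p : Plane} (hp : p ∈ broom) : |p 0| ≤ 1 ∧ 0 ≤ p 1 ∧ p 1 ≤ 1 := by
  have key : ∀ (c d : ℝ), |c| ≤ 1 → |d| ≤ 1 → ∀ p : Plane,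
      p ∈ segment ℝ (!₂[c, 0] : Plane) !₂[d, 1] → |p 0| ≤ 1 ∧ 0 ≤ p 1 ∧ p 1 ≤ 1 := by
    rintro c d hc hd p ⟨a, b, ha, hb, hab, rfl⟩
    rw [abs_le] at *
    simp
    refine ⟨?_, hb, by linarith⟩
    constructor <;> nlinarith
  have h0 : (0 : Plane) = !₂[0, 0] := by ext i; fin_cases i <;> simp
  have hn : ∀ n : ℕ, |1 / ((n : ℝ) + 1)| ≤ 1 := fun n => by
    rw [abs_of_nonneg (by positivity), div_le_one (by positivity)]
    linarith [n.cast_nonneg (α := ℝ)]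
  rcases hp with (hp | hp) | (hp | hp)
  · exact key 0 (-1) (by simp) (by simp) p (h0 ▸ hp)
  · obtain ⟨n, hn'⟩ := mem_iUnion.1 hp
    exact key _ (-1) (by rw [abs_neg]; exact hn n) (by simp) p hn'
  · exact key 0 1 (by simp) (by simp) p (h0 ▸ hp)
  · obtain ⟨n, hn'⟩ := mem_iUnion.1 hp
    exact key _ 1 (hn n) (by simp) p hn'

theorem isCompact_broom_aux (c : ℕ → Plane) (l e : Plane) (hc : Tendsto c atTop (𝓝 l)) :
    IsCompact (segment ℝ l e ∪ ⋃ n : ℕ, segment ℝ (c n) e) := by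
  have h1 : IsCompact (insert l (range c)) := hc.isCompact_insert_range
  have h2 := (h1.prod (isCompact_Icc (a := (0 : ℝ)) (b := 1))).image
    (f := fun q : Plane × ℝ => q.1 + q.2 • (e - q.1)) (by fun_prop)
  convert h2 using 1
  ext p
  simp only [segment_eq_image', mem_union, mem_iUnion, mem_image, Prod.exists, mem_prod,
    mem_insert_iff, mem_range]
  constructor
  · rintro (⟨t, ht, rfl⟩ | ⟨n, t, ht, rfl⟩)
    · exact ⟨l, t, ⟨Or.inl rfl, ht⟩, rfl⟩
    · exact ⟨c n, t, ⟨Or.inr ⟨n, rfl⟩, ht⟩, rfl⟩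
  · rintro ⟨a, t, ⟨rfl | ⟨n, rfl⟩, ht⟩, rfl⟩
    · exact Or.inl ⟨t, ht, rfl⟩
    · exact Or.inr ⟨n, t, ht, rfl⟩

theorem isCompact_broom : IsCompact broom := by
  have hl : Tendsto (fun n : ℕ => 1 / ((n : ℝ) + 1)) atTop (𝓝 0) :=
    tendsto_one_div_add_atTop_nhds_zero_nat
  have h0 : (0 : Plane) = !₂[0, 0] := by ext i; fin_cases i <;> simp
  have hcont : Continuous (fun x : ℝ => (!₂[x, 0] : Plane)) := by fun_prop
  refine (isCompact_broom_aux _ _ _ ?_).union (isCompact_broom_aux _ _ _ ?_)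
  · rw [h0]
    have hl' : Tendsto (fun n : ℕ => -(1 / ((n : ℝ) + 1))) atTop (𝓝 0) := by
      have := hl.neg
      rwa [neg_zero] at this
    exact (hcont.tendsto 0).comp hl'
  · rw [h0]
    exact (hcont.tendsto 0).comp hl

theorem exists_dense_circle_seq : ∃ m : ℕ → Plane, Function.Injective m ∧ (∀ i, ‖m i‖ = 1) ∧
    Metric.sphere (0 : Plane) 1 ⊆ closure (range m) := by
  obtain ⟨t, ht, hc, hd⟩ :=
    TopologicalSpace.IsSeparable.exists_countable_dense_subset
      (TopologicalSpace.IsSeparable.of_separableSpace (Metric.sphere (0 : Plane) 1))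
  have hinf : t.Infinite := by
    intro hfin
    have h1 : Metric.sphere (0 : Plane) 1 ⊆ t := by
      rwa [hfin.isClosed.closure_eq] at hd
    have h2 := hfin.subset h1
    refine (Set.infinite_of_injective_forall_mem (f := fun n : ℕ =>
      (!₂[1 / ((n : ℝ) + 1), √(1 - (1 / ((n : ℝ) + 1)) ^ 2)] : Plane)) ?_ ?_) h2
    · intro a b hab
      have := congrArg (fun p : Plane => p 0) hab
      simpa using this
    · intro n
      have h3 : (1 / ((n : ℝ) + 1)) ≤ 1 := by
        rw [div_le_one (by positivity)]; linarith [n.cast_nonneg (α := ℝ)]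
      have h4 : 0 ≤ 1 / ((n : ℝ) + 1) := by positivity
      rw [mem_sphere_zero_iff_norm, EuclideanSpace.norm_eq, Real.sqrt_eq_one]
      simp only [Fin.sum_univ_two, Real.norm_eq_abs, sq_abs]
      simp only [Matrix.cons_val_zero, Matrix.cons_val_one]
      rw [Real.sq_sqrt (by nlinarith)]
      ring
  have : Infinite t := hinf.to_subtype
  have : Countable t := hc.to_subtype
  obtain ⟨D⟩ := nonempty_denumerable t
  refine ⟨fun n => ((Denumerable.eqv t).symm n : Plane),
    Subtype.val_injective.comp (Denumerable.eqv t).symm.injective, fun i => ?_, ?_⟩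
  · exact mem_sphere_zero_iff_norm.1 (ht ((Denumerable.eqv t).symm i).2)
  · convert hd using 2
    ext x
    constructor
    · rintro ⟨n, rfl⟩; exact ((Denumerable.eqv t).symm n).2
    · intro hx; exact ⟨Denumerable.eqv t ⟨x, hx⟩, by simp⟩

theorem norm_sq_plane (p : Plane) : ‖p‖ ^ 2 = p 0 ^ 2 + p 1 ^ 2 := by
  rw [EuclideanSpace.norm_sq_eq]; simp

theorem placeBroom_norm (m : Plane) (hm : ‖m‖ = 1) (s : ℝ) (hs : 0 < s) (p : Plane)
    (hp : p ∈ broom) : 1 + s * (p 1 + |p 0|) ≤ ‖placeBroom m s p‖ ∧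
      ‖placeBroom m s p - m‖ ≤ 2 * (s * (p 1 + |p 0|)) := by
  obtain ⟨h1, h2, h3⟩ := broom_bounds hp
  have hm2 := norm_sq_plane m
  rw [hm] at hm2
  have ha := abs_nonneg (p 0)
  have ha2 := sq_abs (p 0)
  have hh : 0 ≤ s * (p 1 + |p 0|) := by positivity
  constructor
  · apply le_of_sq_le_sq _ (norm_nonneg _)
    rw [norm_sq_plane]
    simp only [placeBroom, PiLp.toLp_apply, Matrix.cons_val_zero, Matrix.cons_val_one]
    nlinarith [sq_nonneg (s * p 0)]
  · apply le_of_sq_le_sq _ (by positivity)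
    rw [norm_sq_plane]
    simp only [placeBroom, Matrix.cons_val_zero, Matrix.cons_val_one,
      PiLp.sub_apply]
    have h4 : s * |p 0| ≤ s * (p 1 + |p 0|) := by nlinarith
    have h5 : (s * |p 0|) ^ 2 ≤ (s * (p 1 + |p 0|)) ^ 2 :=
      pow_le_pow_left₀ (by positivity) h4 2
    rw [mul_pow, ha2] at h5
    nlinarith

theorem placeBroom_injective (m : Plane) (hm : ‖m‖ = 1) (s : ℝ) (hs : 0 < s) :
    Function.Injective (placeBroom m s) := by
  intro p q hpq
  have hm2 := norm_sq_plane m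
  rw [hm] at hm2
  have e0 := congrArg (fun r : Plane => r 0) hpq
  have e1 := congrArg (fun r : Plane => r 1) hpq
  simp only [placeBroom, PiLp.toLp_apply, Matrix.cons_val_zero, Matrix.cons_val_one] at e0 e1
  have h0 : s * p 0 = s * q 0 := by linear_combination m 0 * e1 - m 1 * e0 + (s * p 0 - s * q 0) * hm2
  have h0' : p 0 = q 0 := mul_left_cancel₀ hs.ne' h0
  rw [h0'] at e0 e1
  have h1 : s * p 1 = s * q 1 := by linear_combination m 1 * e1 + m 0 * e0 + (s * p 1 - s * q 1) * hm2
  have h1' : p 1 = q 1 := mul_left_cancel₀ hs.ne' h1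
  ext i
  fin_cases i
  · exact h0'
  · exact h1'

instance : Nonempty HairyDisk := by
  obtain ⟨m, hinj, hm, hd⟩ := exists_dense_circle_seq
  have hs : ∀ i : ℕ, ∃ s : ℝ, 0 < s ∧ s < (1 / 2) ^ i ∧ ∀ j < i, s < dist (m i) (m j) / 12 := by
    intro i
    have h1 : ∀ᶠ s : ℝ in 𝓝[>] 0, ∀ j ∈ Set.Iio i, s < dist (m i) (m j) / 12 := by
      rw [Filter.eventually_all_finite (Set.finite_Iio i)]
      intro j hj
      have : 0 < dist (m i) (m j) / 12 :=
        div_pos (dist_pos.2 fun h => (ne_of_gt hj) (hinj h)) (by norm_num)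
      exact nhdsWithin_le_nhds (Iio_mem_nhds this)
    have h2 : ∀ᶠ s : ℝ in 𝓝[>] 0, s < (1 / 2) ^ i :=
      nhdsWithin_le_nhds (Iio_mem_nhds (by positivity))
    obtain ⟨s, h3, h4, h5⟩ := ((eventually_mem_nhdsWithin (a := (0 : ℝ)) (s := Set.Ioi 0)).and (h2.and h1)).exists
    exact ⟨s, h3, h4, h5⟩
  choose s hs0 hs1 hs2 using hs
  have : CompactSpace broom := isCompact_iff_compactSpace.1 isCompact_broom
  have hcont : ∀ i, Continuous fun p : broom => placeBroom (m i) (s i) p := fun i => by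
    unfold placeBroom
    fun_prop
  have hcen : ∀ i, placeBroom (m i) (s i) 0 = m i := fun i => by
    ext k; fin_cases k <;> simp [placeBroom]
  have hclose : ∀ i (p : broom), ‖placeBroom (m i) (s i) p - m i‖ ≤ 4 * s i := fun i p => by
    have h1 := (placeBroom_norm (m i) (hm i) (s i) (hs0 i) p p.2).2
    obtain ⟨h2, h3, h4⟩ := broom_bounds p.2
    nlinarith [hs0 i]
  have hlt : ∀ i j, j < i → ∀ p q : broom,
      placeBroom (m i) (s i) p ≠ placeBroom (m j) (s j) q := by
    intro i j hij p q h
    have h1 := hclose i p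
    have h2 := placeBroom_norm (m j) (hm j) (s j) (hs0 j) q q.2
    have h3 := hs2 i j hij
    rw [← h] at h2
    set r := placeBroom (m i) (s i) p
    have h4 : ‖r‖ ≤ 1 + 4 * s i := by
      calc ‖r‖ = ‖m i + (r - m i)‖ := by congr 1; abel
        _ ≤ ‖m i‖ + ‖r - m i‖ := norm_add_le _ _
        _ ≤ _ := by rw [hm i]; linarith
    have h5 : dist (m i) (m j) ≤ ‖r - m i‖ + ‖r - m j‖ := by
      rw [← dist_eq_norm, ← dist_eq_norm]
      exact dist_triangle_left _ _ _
    linarith [h2.1, h2.2]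
  refine ⟨⟨m, hm, hd, fun i p => placeBroom (m i) (s i) p, fun i => ?_, hcen, fun i => ?_, ?_, ?_⟩⟩
  · exact ((hcont i).isClosedEmbedding
      ((placeBroom_injective (m i) (hm i) (s i) (hs0 i)).comp Subtype.val_injective)).isEmbedding
  · ext r
    simp only [mem_inter_iff, mem_range, mem_closedBall_zero_iff, mem_singleton_iff]
    constructor
    · rintro ⟨⟨p, rfl⟩, h⟩
      have h1 := placeBroom_norm (m i) (hm i) (s i) (hs0 i) p p.2
      have h2 : ‖placeBroom (m i) (s i) p - m i‖ ≤ 0 := by linarith [h1.1, h1.2]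
      exact sub_eq_zero.1 (norm_le_zero_iff.1 h2)
    · rintro rfl
      exact ⟨⟨broomCenter, hcen i⟩, (hm i).le⟩
  · intro i j hij
    rw [Set.disjoint_left]
    rintro r ⟨p, rfl⟩ ⟨q, hq⟩
    rcases lt_or_gt_of_ne hij with h | h
    · exact hlt j i h q p hq
    · exact hlt i j h p q hq.symm
  · refine squeeze_zero (g := fun i => 8 * (1 / 2 : ℝ) ^ i) (fun i => Metric.diam_nonneg) (fun i => ?_) ?_
    · refine Metric.diam_le_of_forall_dist_le (by positivity) ?_
      rintro _ ⟨p, rfl⟩ _ ⟨q, rfl⟩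
      have h1 := hclose i p
      have h2 := hclose i q
      rw [← dist_eq_norm] at h1 h2
      linarith [dist_triangle_right (placeBroom (m i) (s i) p) (placeBroom (m i) (s i) q) (m i),
        hs1 i]
    · simpa using (tendsto_pow_atTop_nhds_zero_of_lt_one (r := (1 / 2 : ℝ)) (by norm_num)
        (by norm_num)).const_mul 8

end

/-! ### Upper bound for the small inductive dimension -/

/-! The center of an attached broom is rigid. The endpoints of the prongs converge to the center,
yet a prong can be left only through the apex of its half. During a homotopy that starts at the
identity, as long as the center stays away from the apices, the endpoints of far prongs stay in
their prongs. Their limit, the moving center, therefore stays in the left half and likewise in the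
right half, and these meet only in the center. So every self-map homotopic to the identity fixes the
center and keeps far prong ends in their prongs (`IsProngSystem.apply_eq_of_two`,
`IsAttachedBroom.fixed_and_eventually`). Since the hair centers are dense in the boundary circles,
such a self-map of the wedge fixes these circles pointwise (`HairyDisk.fixed_of_norm_eq_one`).

Suppose that `f` from the wedge to the wedge with a broom and `g` back are homotopy inverse, and let
`b` be the center of the additional broom. The point `g b` is not a point of local connectedness,
because `f ∘ g` keeps prong ends arbitrarily close to `b` inside prongs, away from `b`
(`IsAttachedBroom.not_locally_connected`). It is not a point of a hair other than its center,
because half a hair is a cone whose rays meet in the apex, while `f` would have to keep the rays in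
separate prongs (`IsAttachedBroom.apply_center_ne`). So `g b` lies on a boundary circle. As `g ∘ f`
fixes this circle, `f` embeds it, with `b` on the image. Without `b` the image is still connected,
hence lies in one half of the broom or outside the broom. In each of these an arc can leave `b` in
one direction only, a contradiction (`IsAttachedBroom.false_of_arc`).

For `h`-equality, the wedge is a retract of the wedge with a broom. Conversely, the broom can be
hidden in the first factor: shift all factors by one and embed the broom as a hair of the vacated
first factor. To return, collapse the first factor to that hair and shift back. The composite is the
identity except on the connecting segment, which it maps to itself.

The dimension is at most `2` because every point has at most two coordinates outside a fixed
countable set, and at least `2` because the space contains a disk; the latter rests on the frontier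
of a bounded nonempty open plane set not being totally disconnected. The parameter `T` in the second
half of the file treats the wedges with and without the origin simultaneously. -/

theorem exists_Ioo_endpoints_not_mem {C : Set ℝ} (hC : C.Countable) (x : ℝ) {ε : ℝ} (hε : 0 < ε) :
    ∃ a b : ℝ, a ∉ C ∧ b ∉ C ∧ x ∈ Ioo a b ∧ Ioo a b ⊆ Ioo (x - ε) (x + ε) := by
  have hd := hC.dense_compl ℝ
  obtain ⟨a, ha, ha'⟩ := hd.exists_between (show x - ε < x by linarith)
  obtain ⟨b, hb, hb'⟩ := hd.exists_between (show x < x + ε by linarith)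
  exact ⟨a, b, ha, hb, ⟨ha'.2, hb'.1⟩, Ioo_subset_Ioo ha'.1.le hb'.2.le⟩

/-- The preimages of the boxes whose endpoints avoid a countable set form a basis. -/
theorem isTopologicalBasis_preimage_boxes {m : ℕ} {C : Set ℝ} (hC : C.Countable) {X : Type}
    [TopologicalSpace X] {φ : X → Fin m → ℝ} (hφ : IsInducing φ) :
    TopologicalSpace.IsTopologicalBasis {U | ∃ a b : Fin m → ℝ, (∀ i, a i ∉ C) ∧ (∀ i, b i ∉ C) ∧
      U = φ ⁻¹' (pi univ fun i => Ioo (a i) (b i))} := by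
  refine TopologicalSpace.isTopologicalBasis_of_isOpen_of_nhds ?_ ?_
  · rintro _ ⟨a, b, -, -, rfl⟩
    exact (isOpen_set_pi finite_univ fun i _ => isOpen_Ioo).preimage hφ.continuous
  · intro x U hx hU
    obtain ⟨V, hV, rfl⟩ := hφ.isOpen_iff.1 hU
    obtain ⟨ε, hε, hball⟩ := Metric.isOpen_iff.1 hV (φ x) hx
    choose a b ha hb hx' hab using fun i => exists_Ioo_endpoints_not_mem hC (φ x i) hε
    refine ⟨_, ⟨a, b, ha, hb, rfl⟩, fun i _ => hx' i, fun y hy => hball ?_⟩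
    rw [Metric.mem_ball, dist_pi_lt_iff hε]
    intro i
    have := hab i (hy i (mem_univ i))
    rw [Real.dist_eq, abs_lt]
    constructor <;> linarith [this.1, this.2]

theorem frontier_preimage_box_subset {m : ℕ} {X : Type} [TopologicalSpace X] {φ : X → Fin m → ℝ}
    (hφ : Continuous φ) (a b : Fin m → ℝ) :
    frontier (φ ⁻¹' (pi univ fun i => Ioo (a i) (b i))) ⊆ {x | ∃ i, φ x i = a i ∨ φ x i = b i} := by
  intro x hx
  have ho : IsOpen (φ ⁻¹' (pi univ fun i => Ioo (a i) (b i))) :=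
    (isOpen_set_pi finite_univ fun i _ => isOpen_Ioo).preimage hφ
  rw [ho.frontier_eq] at hx
  have h1 : x ∈ φ ⁻¹' (pi univ fun i => Icc (a i) (b i)) :=
    closure_minimal (preimage_mono (pi_mono fun i _ => Ioo_subset_Icc_self))
      ((isClosed_set_pi fun i _ => isClosed_Icc).preimage hφ) hx.1
  by_contra hcon
  simp only [mem_ofPred_eq, not_exists, not_or] at hcon
  exact hx.2 fun i hi => ⟨lt_of_le_of_ne (h1 i hi).1 (Ne.symm (hcon i).1),
    lt_of_le_of_ne (h1 i hi).2 (hcon i).2⟩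

/-- A space that embeds in `ℝᵐ` such that every point has at most `n` coordinates outside of a fixed
countable set has small inductive dimension at most `n`. -/
theorem hasSmallInductiveDimensionLE_of_countable_coords {m : ℕ} (n : ℕ) :
    ∀ (C : Set ℝ), C.Countable → ∀ (X : Type) [TopologicalSpace X] (φ : X → Fin m → ℝ),
      IsInducing φ → (∀ x, {i | φ x i ∉ C}.ncard ≤ n) → HasSmallInductiveDimensionLE X n := by
  induction n with
  | zero =>
    intro C hC X _ φ hφ h
    refine .succ 0 _ (isTopologicalBasis_preimage_boxes hC hφ) ?_
    rintro _ ⟨a, b, ha, hb, rfl⟩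
    rw [hasSmallInductiveDimensionLT_zero_iff, isEmpty_subtype]
    intro x hx
    obtain ⟨i, hi⟩ := frontier_preimage_box_subset hφ.continuous a b hx
    have h0 := (Set.ncard_eq_zero (toFinite _)).1 (Nat.le_zero.1 (h x))
    have : i ∈ {i | φ x i ∉ C} := by
      rcases hi with hi | hi
      · simp only [mem_ofPred_eq, hi]; exact ha i
      · simp only [mem_ofPred_eq, hi]; exact hb i
    rw [h0] at this
    exact this
  | succ n ih =>
    intro C hC X _ φ hφ h
    refine .succ (n + 1) _ (isTopologicalBasis_preimage_boxes hC hφ) ?_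
    rintro _ ⟨a, b, ha, hb, rfl⟩
    -- At a frontier point some coordinate equals an endpoint of the box. The endpoints avoid `C`,
    -- so adding them to `C` strictly lowers the number of exceptional coordinates.
    refine ih (C ∪ (range a ∪ range b))
      (hC.union ((countable_range a).union (countable_range b))) _ (fun x => φ x.1)
      (hφ.comp IsInducing.subtypeVal) ?_
    rintro ⟨x, hx⟩
    obtain ⟨i, hi⟩ := frontier_preimage_box_subset hφ.continuous a b hx
    have hlt : {i | φ x i ∉ C ∪ (range a ∪ range b)} ⊂ {i | φ x i ∉ C} := by
      refine ssubset_iff_subset_not_subset.2 ⟨fun j hj hC' => hj (Or.inl hC'), fun hsub => ?_⟩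
      have hi' : i ∈ {i | φ x i ∉ C} := by
        rcases hi with hi | hi
        · simp only [mem_ofPred_eq, hi]; exact ha i
        · simp only [mem_ofPred_eq, hi]; exact hb i
      refine hsub hi' (Or.inr ?_)
      rcases hi with hi | hi
      · exact Or.inl ⟨i, hi.symm⟩
      · exact Or.inr ⟨i, hi.symm⟩
    have := Set.ncard_lt_ncard hlt (toFinite _)
    have h2 := h x
    show {i | φ x i ∉ C ∪ (range a ∪ range b)}.ncard ≤ n
    omega

/-! ### Lower bound for the small inductive dimension -/

/-- There is no continuous nonvanishing function on the plane that agrees with `z - p` outside of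
a bounded set. -/
theorem not_exists_nonvanishing_eq_sub (p : ℂ) (R : ℝ) (q : ℂ → ℂ) (hq : Continuous q)
    (h0 : ∀ z, q z ≠ 0) (hR : ∀ z, R ≤ ‖z - p‖ → q z = z - p) : False := by
  -- The plane is simply connected, so `q` has a global logarithm `G`. Along a large circle about
  -- `p` a logarithm of `z - p` gains `2πi` in one turn, which the single-valued `G` cannot do.
  obtain ⟨G, ⟨-, hG⟩, -⟩ := Complex.isCoveringMapOn_exp.existsUnique_continuousMap_lifts
    (⟨q, hq⟩ : C(ℂ, ℂ)) (a₀ := 0) (Complex.exp_log (h0 0)) (fun z => h0 z)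
  have hG' : ∀ z, Complex.exp (G z) = q z := fun z => congrFun hG z
  set r := max R 1
  have hr : 0 < r := lt_of_lt_of_le one_pos (le_max_right _ _)
  let h : ℝ → ℂ := fun t => G (p + r * Complex.exp (t * Complex.I)) - t * Complex.I
  have hcont : Continuous h := by fun_prop
  have hexp : ∀ t, Complex.exp (h t) = r := by
    intro t
    rw [Complex.exp_sub, hG', hR]
    · rw [add_sub_cancel_left, mul_div_assoc, div_self (Complex.exp_ne_zero _), mul_one]
    · rw [add_sub_cancel_left, norm_mul, Complex.norm_exp_ofReal_mul_I, mul_one,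
        Complex.norm_real, Real.norm_of_nonneg hr.le]
      exact le_max_left _ _
  have him : Continuous fun t => (h t).im := Complex.continuous_im.comp hcont
  have hper : h (2 * Real.pi) = h 0 - 2 * Real.pi * Complex.I := by
    simp only [h]
    push_cast
    rw [Complex.exp_two_pi_mul_I]
    simp
  have hper' : (h (2 * Real.pi)).im = (h 0).im - 2 * Real.pi := by
    rw [hper]; simp
  -- Since `exp ∘ h` is a positive constant, the cosine of the imaginary part of `h` is always
  -- positive; half way down, it has the wrong sign.
  obtain ⟨t, -, ht⟩ : (h 0).im - Real.pi ∈ (fun t => (h t).im) '' Icc 0 (2 * Real.pi) := by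
    refine intermediate_value_Icc' (by positivity) him.continuousOn ⟨?_, ?_⟩
    · rw [hper']; linarith [Real.pi_pos]
    · linarith [Real.pi_pos]
  have e0 := congrArg Complex.re (hexp 0)
  have e0' := congrArg Complex.im (hexp 0)
  have e1 := congrArg Complex.re (hexp t)
  rw [Complex.exp_re] at e0 e1
  simp only at ht
  rw [ht, Real.cos_sub_pi] at e1
  simp only [Complex.ofReal_re] at e0 e1
  have hc : 0 < Real.cos (h 0).im := by
    have : 0 < Real.exp (h 0).re * Real.cos (h 0).im := by rw [e0]; exact hr
    exact pos_of_mul_pos_right this (Real.exp_pos _).le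
  nlinarith [mul_pos (Real.exp_pos (h t).re) hc]

/-- On a compact totally disconnected space every nonvanishing function has a logarithm. -/
theorem exists_log_of_totallyDisconnected {K : Type} [TopologicalSpace K] [CompactSpace K]
    [T2Space K] [TotallyDisconnectedSpace K] (u : C(K, ℂ)) (hu : ∀ x, u x ≠ 0) :
    ∃ L : C(K, ℂ), ∀ x, Complex.exp (L x) = u x := by
  -- The clopen set `E` contains all points where `u` meets the branch cut and stays in the left
  -- half-plane. The principal branch works off `E`, and the branch cut along the positive axis
  -- works on `E`.
  obtain ⟨E, hE, hZE, hEU⟩ := exists_clopen_of_closed_subset_open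
    (Z := {x : K | (u x).im = 0 ∧ (u x).re ≤ 0}) (U := {x : K | (u x).re < 0})
    ((isClosed_eq (by fun_prop) continuous_const).inter
      (isClosed_le (f := fun x => (u x).re) (by fun_prop) continuous_const))
    (isOpen_lt (by fun_prop) continuous_const)
    (fun x hx => lt_of_le_of_ne hx.2 fun h => hu x (Complex.ext h hx.1))
  classical
  let L : K → ℂ := fun x => if x ∈ E then Complex.log (-u x) + Real.pi * Complex.I
    else Complex.log (u x)
  have hL : Continuous L := by
    rw [continuous_iff_continuousAt]
    intro x
    by_cases hx : x ∈ E
    · have h1 : (fun y => Complex.log (-u y) + Real.pi * Complex.I) =ᶠ[𝓝 x] L := by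
        filter_upwards [hE.isOpen.mem_nhds hx] with y hy
        simp [L, hy]
      refine ContinuousAt.congr ?_ h1
      refine (ContinuousAt.clog (by fun_prop) ?_).add continuousAt_const
      left
      have := hEU hx
      simp only [mem_ofPred_eq] at this
      simpa using this
    · have h1 : (fun y => Complex.log (u y)) =ᶠ[𝓝 x] L := by
        filter_upwards [hE.compl.isOpen.mem_nhds hx] with y hy
        simp [L, (show y ∉ E from hy)]
      refine ContinuousAt.congr ?_ h1
      refine ContinuousAt.clog (by fun_prop) ?_
      rw [Complex.mem_slitPlane_iff_not_le_zero, Complex.le_def]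
      rintro ⟨h2, h3⟩
      exact hx (hZE ⟨h3, h2⟩)
  refine ⟨⟨L, hL⟩, fun x => ?_⟩
  by_cases hx : x ∈ E
  · simp only [ContinuousMap.coe_mk, L, hx, if_true]
    rw [Complex.exp_add, Complex.exp_log (neg_ne_zero.2 (hu x)), Complex.exp_pi_mul_I]
    ring
  · simp only [ContinuousMap.coe_mk, L, hx, if_false]
    exact Complex.exp_log (hu x)

/-- The frontier of a nonempty bounded open subset of the plane is not totally disconnected. -/
theorem not_totallyDisconnected_frontier {W : Set ℂ} (hW : IsOpen W)
    (hb : Bornology.IsBounded W) (hne : W.Nonempty) : ¬ TotallyDisconnectedSpace (frontier W) := by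
  intro htd
  obtain ⟨p, hp⟩ := hne
  have hcomp : CompactSpace (frontier W) := isCompact_iff_compactSpace.1
    (Metric.isCompact_of_isClosed_isBounded isClosed_frontier (hb.closure.subset frontier_subset_closure))
  -- The logarithm of `z - p` on the frontier extends to the plane by Tietze. Its exponential
  -- replaces `z - p` inside `W` and so removes the only zero.
  obtain ⟨L, hL⟩ := exists_log_of_totallyDisconnected
    (⟨fun x : frontier W => (x : ℂ) - p, by fun_prop⟩ : C(frontier W, ℂ)) (fun x hx => by
      have h1 : (x : ℂ) = p := sub_eq_zero.1 hx
      have h2 := x.2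
      rw [h1, hW.frontier_eq] at h2
      exact h2.2 hp)
  obtain ⟨G, hG⟩ := ContinuousMap.exists_restrict_eq isClosed_frontier L
  have hG' : ∀ z ∈ frontier W, Complex.exp (G z) = z - p := by
    intro z hz
    have h1 := hL ⟨z, hz⟩
    rw [← hG] at h1
    exact h1
  classical
  let q : ℂ → ℂ := fun z => if z ∈ W then Complex.exp (G z) else z - p
  have hcont : Continuous q := by
    refine Continuous.if (fun z hz => hG' z hz) (by fun_prop) (by fun_prop)
  obtain ⟨R, hR⟩ := hb.subset_ball p
  refine not_exists_nonvanishing_eq_sub p R q hcont (fun z => ?_) (fun z hz => ?_)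
  · by_cases h : z ∈ W
    · simp only [q, h, if_true]; exact Complex.exp_ne_zero _
    · simp only [q, h, if_false]
      exact sub_ne_zero.2 fun h' => h (h' ▸ hp)
  · have h : z ∉ W := fun h => by
      have := hR h
      rw [Metric.mem_ball, dist_eq_norm] at this
      linarith
    simp [q, h]

/-- A Hausdorff space that contains a disk has small inductive dimension at least `2`. -/
theorem not_hasSmallInductiveDimensionLT_two {X : Type} [TopologicalSpace X] [T2Space X]
    (φ : ℂ → X) (hφ : ContinuousOn φ (Metric.closedBall 0 1))
    (hinj : InjOn φ (Metric.closedBall 0 1)) : ¬ HasSmallInductiveDimensionLT X 2 := by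
  intro h
  obtain _ | ⟨_, s, hs, h⟩ := h
  have hsph : IsCompact (φ '' Metric.sphere 0 1) :=
    (isCompact_sphere _ _).image_of_continuousOn (hφ.mono Metric.sphere_subset_closedBall)
  have h0 : φ 0 ∈ (φ '' Metric.sphere 0 1)ᶜ := by
    rintro ⟨z, hz, hz'⟩
    have := hinj (Metric.sphere_subset_closedBall hz) (by simp) hz'
    subst this
    simp at hz
  -- Because `V` misses the image of the bounding circle, the frontier of its trace `W` on the open
  -- disk is carried injectively into the totally disconnected frontier of `V`.
  obtain ⟨V, hV, h0V, hVO⟩ := hs.exists_subset_of_mem_open h0 hsph.isClosed.isOpen_compl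
  have hVo := hs.isOpen hV
  have hclopen := hasSmallInductiveDimensionLT_one_iff.1 (h V hV)
  have hts : TotallySeparatedSpace (frontier V) := totallySeparatedSpace_of_t0_of_basis_clopen hclopen
  set W : Set ℂ := Metric.ball 0 1 ∩ φ ⁻¹' V
  have hWo : IsOpen W :=
    (hφ.mono Metric.ball_subset_closedBall).isOpen_inter_preimage Metric.isOpen_ball hVo
  have hcl : closure W ⊆ Metric.closedBall 0 1 :=
    closure_minimal (inter_subset_left.trans Metric.ball_subset_closedBall) Metric.isClosed_closedBall
  have hfr : ∀ z ∈ frontier W, φ z ∈ frontier V := by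
    intro z hz
    rw [hWo.frontier_eq] at hz
    rw [hVo.frontier_eq]
    have hzc := hcl hz.1
    refine ⟨?_, fun hzV => ?_⟩
    · have h1 : ContinuousWithinAt φ W z :=
        (hφ z hzc).mono (inter_subset_left.trans Metric.ball_subset_closedBall)
      exact closure_mono (image_subset_iff.2 inter_subset_right)
        (h1.mem_closure_image hz.1)
    · rcases (Metric.sphere_union_ball (x := (0 : ℂ)) (ε := 1)).symm ▸ hzc with hzs | hzb
      · exact hVO hzV ⟨z, hzs, rfl⟩
      · exact hz.2 ⟨hzb, hzV⟩
  refine not_totallyDisconnected_frontier hWo (Metric.isBounded_ball.subset inter_subset_left)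
    ⟨0, by simp, h0V⟩ ⟨?_⟩
  let ψ : frontier W → frontier V := fun z => ⟨φ z, hfr z z.2⟩
  have hfc : ∀ z ∈ frontier W, z ∈ Metric.closedBall (0 : ℂ) 1 := fun z hz =>
    hcl (frontier_subset_closure hz)
  have hψ : Continuous ψ :=
    (continuousOn_iff_continuous_domRestrict.1 (hφ.mono hfc)).subtype_mk _
  refine isTotallyDisconnected_of_image hψ.continuousOn ?_
    (isTotallyDisconnected_of_totallyDisconnectedSpace _)
  intro z w hzw
  exact Subtype.ext (hinj (hfc z z.2) (hfc w w.2) (congrArg Subtype.val hzw))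

/-! ### Systems of prongs and homotopically fixed points -/

/-- A system of prongs at the point `v`: sets `P n ⊆ F` which contain points `a n` converging to `v`,
and which cannot be left along connected subsets of the neighborhood `U` of `v`. -/
structure IsProngSystem {Z : Type} [TopologicalSpace Z] (v : Z) (U F : Set Z) (a : ℕ → Z)
    (P : ℕ → Set Z) : Prop where
  mem_nhds : U ∈ 𝓝 v
  isClosed : IsClosed F
  tendsto : Tendsto a atTop (𝓝 v)
  mem : ∀ n, a n ∈ P n
  subset : ∀ n, P n ⊆ F
  not_mem : ∀ n, v ∉ P n
  confine : ∀ n S, IsPreconnected S → S ⊆ U → (S ∩ P n).Nonempty → S ⊆ P n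

namespace IsProngSystem

variable {Z : Type} [TopologicalSpace Z] {v : Z} {U F : Set Z} {a : ℕ → Z} {P : ℕ → Set Z}

/-- By the tube lemma the tracks of points near `v` stay in `U` together with the track of `v`. The
track of `a n` is connected and starts in `P n`, hence is confined to it. -/
theorem eventually_forall_mem (hP : IsProngSystem v U F a P) {h : ℝ × Z → Z} (hh : Continuous h)
    (h0 : ∀ z, h (0, z) = z) {T : ℝ} (hT : 0 ≤ T) (hv : ∀ t ∈ Icc 0 T, h (t, v) ∈ interior U) :
    ∀ᶠ n in atTop, ∀ t ∈ Icc 0 T, h (t, a n) ∈ P n := by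
  obtain ⟨u, w, -, hw, hu, hvw, huw⟩ := generalized_tube_lemma (isCompact_Icc (a := (0 : ℝ)) (b := T))
    (isCompact_singleton (x := v)) ((isOpen_interior (s := U)).preimage hh) (by
      rintro ⟨t, z⟩ ⟨ht, hz⟩
      rw [mem_singleton_iff] at hz
      subst hz
      exact hv t ht)
  filter_upwards [hP.tendsto (hw.mem_nhds (hvw rfl))] with n hn t ht
  refine hP.confine n ((fun t => h (t, a n)) '' Icc 0 T)
    (isPreconnected_Icc.image _ (by fun_prop)) ?_ ?_ ⟨t, ht, rfl⟩
  · rintro _ ⟨s, hs, rfl⟩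
    exact interior_subset (huw (mk_mem_prod (hu hs) hn))
  · exact ⟨a n, ⟨0, ⟨le_rfl, hT⟩, h0 _⟩, hP.mem n⟩

/-- The times up to which `v` has not moved form a closed set. Just after such a time `v` is still
in `U ∩ U'`, and its position is a limit of points of the closed set `F` and of points of `F'`,
hence lies in `F ∩ F'`. -/
theorem apply_eq_of_two {F' : Set Z} {U' : Set Z} {a' : ℕ → Z} {P' : ℕ → Set Z}
    (hP : IsProngSystem v U F a P) (hP' : IsProngSystem v U' F' a' P') (hF : F ∩ F' ⊆ {v})
    (hv : IsClosed {v}) {h : ℝ × Z → Z} (hh : Continuous h) (h0 : ∀ z, h (0, z) = z) {T : ℝ} :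
    ∀ t ∈ Icc 0 T, h (t, v) = v := by
  set S : Set ℝ := {t | h (t, v) = v}
  have hS : IsClosed S := hv.preimage (f := fun t => h (t, v)) (by fun_prop)
  rcases lt_or_ge T 0 with hT | hT
  · intro t ht; linarith [ht.1, ht.2]
  refine (hS.inter isClosed_Icc).Icc_subset_of_forall_mem_nhdsGT_of_Icc_subset (h0 v) ?_
  intro t ht hsub
  have hc : ContinuousAt (fun t => h (t, v)) t := by fun_prop
  have hI : ∀ᶠ s in 𝓝 t, h (s, v) ∈ interior U ∩ interior U' := by
    refine hc.eventually ?_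
    simp only [show h (t, v) = v from hsub ⟨ht.1, le_rfl⟩]
    exact inter_mem (interior_mem_nhds.2 hP.mem_nhds) (interior_mem_nhds.2 hP'.mem_nhds)
  obtain ⟨ε, hε, hball⟩ := Metric.eventually_nhds_iff_ball.1 hI
  have key : ∀ s ∈ Ioo t (t + ε), s ∈ S := by
    intro s hs
    have hU : ∀ r ∈ Icc 0 s, h (r, v) ∈ interior U ∩ interior U' := by
      intro r hr
      rcases le_total r t with hrt | hrt
      · rw [show h (r, v) = v from hsub ⟨hr.1, hrt⟩]
        exact ⟨mem_interior_iff_mem_nhds.2 hP.mem_nhds, mem_interior_iff_mem_nhds.2 hP'.mem_nhds⟩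
      · refine hball r ?_
        rw [Real.ball_eq_Ioo]
        constructor <;> linarith [hr.2, hs.2]
    have hs0 : 0 ≤ s := ht.1.trans hs.1.le
    have hcs : Continuous fun z => h (s, z) := by fun_prop
    have lim : ∀ {U F : Set Z} {a : ℕ → Z} {P : ℕ → Set Z}, IsProngSystem v U F a P →
        (∀ r ∈ Icc 0 s, h (r, v) ∈ interior U) → h (s, v) ∈ F := fun hQ hU =>
      hQ.isClosed.mem_of_tendsto ((hcs.tendsto v).comp hQ.tendsto)
        ((hQ.eventually_forall_mem hh h0 hs0 hU).mono
          fun n hn => hQ.subset n (hn s ⟨hs0, le_rfl⟩))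
    exact hF ⟨lim hP fun r hr => (hU r hr).1, lim hP' fun r hr => (hU r hr).2⟩
  exact mem_of_superset (Ioo_mem_nhdsGT (by linarith)) key

/-- A small connected neighborhood of `x` contains some `y n`. Its image lies in `U` and meets a
prong, so it is contained in this prong although it contains `v`. -/
theorem not_mem_of_isPreconnected {X : Type} [TopologicalSpace X] (hP : IsProngSystem v U F a P)
    {f : X → Z} (hf : Continuous f) {x : X} (hx : f x = v) {y : ℕ → X} (hy : Tendsto y atTop (𝓝 x))
    (hyP : ∀ᶠ n in atTop, f (y n) ∈ P n)
    (hloc : ∀ N ∈ 𝓝 x, ∃ M ∈ 𝓝 x, M ⊆ N ∧ IsPreconnected M) : False := by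
  obtain ⟨M, hM, hMN, hMc⟩ := hloc (f ⁻¹' U) (hf.continuousAt (hx ▸ hP.mem_nhds))
  obtain ⟨n, hn, hn'⟩ := (hyP.and (hy hM)).exists
  refine hP.not_mem n (hP.confine n (f '' M) (hMc.image _ hf.continuousOn)
    (image_subset_iff.2 hMN) ⟨_, ⟨_, hn', rfl⟩, hn⟩ ⟨x, mem_of_mem_nhds hM, hx⟩)

/-- The confinement argument for paths with varying parameters and starting times, as they occur
along the rays of a cone. -/
theorem eventually_forall_mem_of_tendsto {C : Type} [TopologicalSpace C]
    (hP : IsProngSystem v U F a P) {φ : C × ℝ → Z} (hφ : Continuous φ) {c : ℕ → C} {c₀ : C}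
    (hc : Tendsto c atTop (𝓝 c₀)) {s : ℕ → ℝ} {s₀ s₁ : ℝ} (hs : Tendsto s atTop (𝓝 s₀))
    (h01 : s₀ ≤ s₁) (hU : ∀ t ∈ Icc s₀ s₁, φ (c₀, t) ∈ interior U) {n : ℕ → ℕ}
    (hn : ∀ᶠ k in atTop, φ (c k, s k) ∈ P (n k)) :
    ∀ᶠ k in atTop, ∀ t ∈ Icc s₀ s₁, φ (c k, t) ∈ P (n k) := by
  obtain ⟨u, w, hu, hw, hcu, hsw, huw⟩ := generalized_tube_lemma (isCompact_singleton (x := c₀))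
    (isCompact_Icc (a := s₀) (b := s₁)) ((isOpen_interior (s := U)).preimage hφ) (by
      rintro ⟨c, t⟩ ⟨hc, ht⟩
      rw [mem_singleton_iff] at hc
      subst hc
      exact hU t ht)
  have h1 : ∀ᶠ k in atTop, uIcc (s k) s₀ ⊆ w :=
    (hs.uIcc tendsto_const_nhds).eventually
      (eventually_smallSets_subset.2 (hw.mem_nhds (hsw ⟨le_rfl, h01⟩)))
  filter_upwards [h1, hc (hu.mem_nhds (hcu rfl)), hn] with k hk hck hnk t ht
  -- The starting time `s k` may lie on either side of `s₀`; the unordered interval bridges the gap.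
  refine hP.confine (n k) ((fun t => φ (c k, t)) '' (uIcc (s k) s₀ ∪ Icc s₀ s₁))
    (IsPreconnected.image ?_ _ (by fun_prop)) ?_ ⟨_, ⟨s k, Or.inl left_mem_uIcc, rfl⟩, hnk⟩
    ⟨t, Or.inr ht, rfl⟩
  · exact IsPreconnected.union s₀ right_mem_uIcc ⟨le_rfl, h01⟩ isPreconnected_uIcc
      isPreconnected_Icc
  · rintro _ ⟨r, hr, rfl⟩
    exact interior_subset (huw (mk_mem_prod hck (hr.elim (fun h => hk h) (fun h => hsw h))))

/-- A cone `φ` over `C` cannot be mapped in such a way that points converging to a point over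
`v` end up in different prongs of a pair of prong systems at `v`. -/
theorem false_of_cone {C : Type} [TopologicalSpace C] {F' : Set Z} {U' : Set Z} {a' : ℕ → Z}
    {P' : ℕ → Set Z} (hP : IsProngSystem v U F a P) (hP' : IsProngSystem v U' F' a' P')
    (hF : F ∩ F' ⊆ {v}) (hv : IsClosed {v}) {φ : C × ℝ → Z} (hφ : Continuous φ) {c c' : ℕ → C}
    {c₀ : C} (hc : Tendsto c atTop (𝓝 c₀)) {s s' : ℕ → ℝ} {s₀ : ℝ} (hs : Tendsto s atTop (𝓝 s₀))
    (h01 : s₀ ≤ 1) (hv0 : φ (c₀, s₀) = v) (hapex : ∀ c, φ (c, 1) = φ (c₀, 1)) {n : ℕ → ℕ}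
    (hn : ∀ᶠ k in atTop, φ (c k, s k) ∈ P (n k))
    (h' : s₀ < 1 → Tendsto c' atTop (𝓝 c₀) ∧ Tendsto s' atTop (𝓝 s₀) ∧
      ∀ᶠ k in atTop, φ (c' k, s' k) ∈ P' k) : False := by
  set S : Set ℝ := {t | φ (c₀, t) = v}
  have hS : IsClosed S := hv.preimage (f := fun t => φ (c₀, t)) (by fun_prop)
  have hUU' : v ∈ interior U ∩ interior U' :=
    ⟨mem_interior_iff_mem_nhds.2 hP.mem_nhds, mem_interior_iff_mem_nhds.2 hP'.mem_nhds⟩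
  -- The ray through `c₀` cannot leave `v` before the apex, for the reason that pins `v` under
  -- homotopies: it is squeezed between rays in `F` and rays in `F'`.
  have hall : Icc s₀ 1 ⊆ S := by
    refine (hS.inter isClosed_Icc).Icc_subset_of_forall_mem_nhdsGT_of_Icc_subset hv0 ?_
    intro t ht hsub
    obtain ⟨hc', hs', hn'⟩ := h' (ht.1.trans_lt ht.2)
    have hcont : ContinuousAt (fun t => φ (c₀, t)) t := by fun_prop
    have hI : ∀ᶠ s in 𝓝 t, φ (c₀, s) ∈ interior U ∩ interior U' := by
      refine hcont.eventually ?_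
      simp only [show φ (c₀, t) = v from hsub ⟨ht.1, le_rfl⟩]
      exact inter_mem (isOpen_interior.mem_nhds hUU'.1) (isOpen_interior.mem_nhds hUU'.2)
    obtain ⟨ε, hε, hball⟩ := Metric.eventually_nhds_iff_ball.1 hI
    have key : ∀ r ∈ Ioo t (t + ε), r ∈ S := by
      intro r hr
      have hU : ∀ q ∈ Icc s₀ r, φ (c₀, q) ∈ interior U ∩ interior U' := by
        intro q hq
        rcases le_total q t with hqt | hqt
        · rw [show φ (c₀, q) = v from hsub ⟨hq.1, hqt⟩]
          exact hUU'
        · refine hball q ?_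
          rw [Real.ball_eq_Ioo]
          constructor <;> linarith [hq.2, hr.2]
      have hr0 : s₀ ≤ r := ht.1.trans hr.1.le
      have hcr : Continuous fun c => φ (c, r) := by fun_prop
      refine hF ⟨?_, ?_⟩
      · exact hP.isClosed.mem_of_tendsto ((hcr.tendsto c₀).comp hc)
          ((hP.eventually_forall_mem_of_tendsto hφ hc hs hr0 (fun q hq => (hU q hq).1) hn).mono
            fun k hk => hP.subset _ (hk r ⟨hr0, le_rfl⟩))
      · exact hP'.isClosed.mem_of_tendsto ((hcr.tendsto c₀).comp hc')
          ((hP'.eventually_forall_mem_of_tendsto hφ hc' hs' hr0 (fun q hq => (hU q hq).2)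
            (n := id) hn').mono fun k hk => hP'.subset _ (hk r ⟨hr0, le_rfl⟩))
    exact mem_of_superset (Ioo_mem_nhdsGT (by linarith)) key
  -- Nearby rays are now confined to their prongs up to the apex. There all rays agree with the ray
  -- through `c₀`, whose value is `v`, but no prong contains `v`.
  obtain ⟨k, hk⟩ := (hP.eventually_forall_mem_of_tendsto hφ hc hs h01
    (fun t ht => (show φ (c₀, t) = v from hall ht) ▸ hUU'.1) hn).exists
  have := hk 1 ⟨h01, le_rfl⟩
  rw [hapex, show φ (c₀, 1) = v from hall ⟨h01, le_rfl⟩] at this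
  exact hP.not_mem _ this

end IsProngSystem

/-! ### Coordinates on the broom -/

/-- The base points `0` and `-1 / (n + 1)` of the left half of the broom. -/
def broomBase : Set ℝ := {c | c = 0 ∨ ∃ n : ℕ, c = -(1 / ((n : ℝ) + 1))}

/-- The point at height `s` of the segment from `(c, 0)` to `(-1, 1)`. -/
def conePoint (c s : ℝ) : Plane := !₂[c - s * (1 + c), s]

@[simp] theorem conePoint_apply_zero (c s : ℝ) : conePoint c s 0 = c - s * (1 + c) := rfl

@[simp] theorem conePoint_apply_one (c s : ℝ) : conePoint c s 1 = s := rfl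

theorem plane_ext {p q : Plane} (h0 : p 0 = q 0) (h1 : p 1 = q 1) : p = q := by
  ext i; fin_cases i
  · exact h0
  · exact h1

theorem segment_eq_conePoint (c : ℝ) :
    segment ℝ (!₂[c, 0] : Plane) !₂[-1, 1] = conePoint c '' Icc 0 1 := by
  rw [segment_eq_image]
  refine image_congr fun t _ => plane_ext ?_ ?_
  · simp; ring
  · simp

theorem mem_broomLeft_iff {p : Plane} :
    p ∈ broomLeft ↔ ∃ c ∈ broomBase, ∃ s ∈ Icc (0 : ℝ) 1, p = conePoint c s := by
  have h0 : (0 : Plane) = !₂[0, 0] := by ext i; fin_cases i <;> simp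
  rw [broomLeft, h0, segment_eq_conePoint]
  simp only [segment_eq_conePoint, mem_union, mem_iUnion, mem_image]
  constructor
  · rintro (⟨s, hs, rfl⟩ | ⟨n, s, hs, rfl⟩)
    · exact ⟨0, Or.inl rfl, s, hs, rfl⟩
    · exact ⟨_, Or.inr ⟨n, rfl⟩, s, hs, rfl⟩
  · rintro ⟨c, rfl | ⟨n, rfl⟩, s, hs, rfl⟩
    · exact Or.inl ⟨s, hs, rfl⟩
    · exact Or.inr ⟨n, s, hs, rfl⟩

/-- The reflection that interchanges the two halves of the broom. -/
def reflectPlane (p : Plane) : Plane := !₂[-p 0, p 1]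

@[simp] theorem reflectPlane_apply_zero (p : Plane) : reflectPlane p 0 = -p 0 := rfl

@[simp] theorem reflectPlane_apply_one (p : Plane) : reflectPlane p 1 = p 1 := rfl

@[simp] theorem reflectPlane_reflectPlane (p : Plane) : reflectPlane (reflectPlane p) = p :=
  plane_ext (by simp) (by simp)

theorem continuous_reflectPlane : Continuous reflectPlane := by
  unfold reflectPlane; fun_prop

theorem segment_reflectPlane (c : ℝ) :
    segment ℝ (!₂[c, 0] : Plane) !₂[1, 1] =
      reflectPlane ⁻¹' segment ℝ (!₂[-c, 0] : Plane) !₂[-1, 1] := by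
  rw [segment_eq_conePoint, segment_eq_image]
  ext p
  simp only [mem_image, mem_preimage]
  refine exists_congr fun t => and_congr_right fun _ => ?_
  constructor
  · rintro rfl
    refine plane_ext ?_ ?_
    · simp; ring
    · simp
  · intro h
    have h0 := congrArg (fun q : Plane => q 0) h
    have h1 := congrArg (fun q : Plane => q 1) h
    simp at h0 h1
    refine plane_ext ?_ ?_
    · simp; linarith
    · simp [h1]

theorem mem_broomRight_iff {p : Plane} : p ∈ broomRight ↔ reflectPlane p ∈ broomLeft := by
  have h0 : (0 : Plane) = !₂[0, 0] := by ext i; fin_cases i <;> simp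
  rw [broomRight, broomLeft, h0, segment_reflectPlane]
  simp only [segment_reflectPlane, neg_zero, mem_union, mem_iUnion, mem_preimage]

theorem broomBase_mem_Icc {c : ℝ} (hc : c ∈ broomBase) : c ∈ Icc (-1 : ℝ) 0 := by
  rcases hc with rfl | ⟨n, rfl⟩
  · simp
  · have : (1 : ℝ) / (n + 1) ≤ 1 := by
      rw [div_le_one (by positivity)]; linarith [n.cast_nonneg (α := ℝ)]
    have h2 : (0 : ℝ) ≤ 1 / (n + 1) := by positivity
    constructor <;> linarith

theorem conePoint_nonpos {c s : ℝ} (hc : c ∈ broomBase) (hs : s ∈ Icc (0 : ℝ) 1) :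
    conePoint c s 0 ≤ 0 := by
  have := broomBase_mem_Icc hc
  simp only [conePoint_apply_zero]
  nlinarith [this.1, this.2, hs.1, hs.2]

theorem eq_zero_of_conePoint {c s : ℝ} (hc : c ∈ broomBase) (hs : s ∈ Icc (0 : ℝ) 1)
    (h : conePoint c s 0 = 0) : conePoint c s = 0 := by
  have := broomBase_mem_Icc hc
  simp only [conePoint_apply_zero] at h
  have h1 : s * (1 + c) = c := by linarith
  have h2 : 0 ≤ s * (1 + c) := mul_nonneg hs.1 (by linarith [this.1])
  have h3 : c = 0 := le_antisymm this.2 (h1 ▸ h2)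
  subst h3
  refine plane_ext ?_ ?_ <;> simp at h1 ⊢ <;> linarith

theorem apply_zero_neg_of_mem_broomLeft {p : Plane} (hp : p ∈ broomLeft) (h0 : p ≠ 0) : p 0 < 0 := by
  obtain ⟨c, hc, s, hs, rfl⟩ := mem_broomLeft_iff.1 hp
  exact lt_of_le_of_ne (conePoint_nonpos hc hs) fun h => h0 (eq_zero_of_conePoint hc hs h)

theorem apply_zero_pos_of_mem_broomRight {p : Plane} (hp : p ∈ broomRight) (h0 : p ≠ 0) :
    0 < p 0 := by
  have := apply_zero_neg_of_mem_broomLeft (mem_broomRight_iff.1 hp) fun h => h0 (by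
    rw [← reflectPlane_reflectPlane p, h]; exact plane_ext (by simp) (by simp))
  simpa using this

theorem broomLeft_inter_broomRight : broomLeft ∩ broomRight ⊆ {0} := by
  rintro p ⟨h1, h2⟩
  by_contra h
  linarith [apply_zero_neg_of_mem_broomLeft h1 h, apply_zero_pos_of_mem_broomRight h2 h]

theorem isCompact_broomBase : IsCompact broomBase := by
  have h := (tendsto_one_div_add_atTop_nhds_zero_nat (𝕜 := ℝ)).neg
  rw [neg_zero] at h
  convert h.isCompact_insert_range using 1
  ext c
  simp [broomBase, eq_comm]

theorem isCompact_broomLeft : IsCompact broomLeft := by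
  have : broomLeft = (fun q : ℝ × ℝ => conePoint q.1 q.2) '' (broomBase ×ˢ Icc 0 1) := by
    ext p
    rw [mem_broomLeft_iff]
    constructor
    · rintro ⟨c, hc, s, hs, rfl⟩; exact ⟨(c, s), ⟨hc, hs⟩, rfl⟩
    · rintro ⟨⟨c, s⟩, ⟨hc, hs⟩, rfl⟩; exact ⟨c, hc, s, hs, rfl⟩
  rw [this]
  refine (isCompact_broomBase.prod isCompact_Icc).image ?_
  unfold conePoint; fun_prop

instance : CompactSpace broom := isCompact_iff_compactSpace.1 isCompact_broom

theorem reflectPlane_mem_broom {p : Plane} (hp : p ∈ broom) : reflectPlane p ∈ broom := by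
  rcases hp with h | h
  · right; rw [mem_broomRight_iff, reflectPlane_reflectPlane]; exact h
  · left; exact mem_broomRight_iff.1 h

/-- The reflection as a self-homeomorphism of the broom. -/
def broomReflect : broom ≃ₜ broom where
  toFun p := ⟨reflectPlane p, reflectPlane_mem_broom p.2⟩
  invFun p := ⟨reflectPlane p, reflectPlane_mem_broom p.2⟩
  left_inv p := Subtype.ext (by simp)
  right_inv p := Subtype.ext (by simp)
  continuous_toFun := (continuous_reflectPlane.comp continuous_subtype_val).subtype_mk _
  continuous_invFun := (continuous_reflectPlane.comp continuous_subtype_val).subtype_mk _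

theorem broomReflect_center : broomReflect broomCenter = broomCenter :=
  Subtype.ext (plane_ext (by simp [broomReflect, broomCenter]) (by simp [broomReflect, broomCenter]))

/-! ### Prongs of the broom -/

/-- The `n`-th prong of the left half of the broom, without the apex. -/
def prong (n : ℕ) : Set broom :=
  {p | p.1 1 < 1 ∧ p.1 0 + p.1 1 = -(1 / ((n : ℝ) + 1)) * (1 - p.1 1)}

theorem conePoint_mem_broom {c s : ℝ} (hc : c ∈ broomBase) (hs : s ∈ Icc (0 : ℝ) 1) :
    conePoint c s ∈ broom := Or.inl (mem_broomLeft_iff.2 ⟨c, hc, s, hs, rfl⟩)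

theorem neg_one_div_mem_broomBase (n : ℕ) : -(1 / ((n : ℝ) + 1)) ∈ broomBase := Or.inr ⟨n, rfl⟩

/-- The apex of the left half of the broom. -/
def leftApex : broom := ⟨conePoint 0 1, conePoint_mem_broom (Or.inl rfl) ⟨zero_le_one, le_rfl⟩⟩

/-- The endpoint of the `n`-th prong of the left half of the broom. -/
noncomputable def prongEnd (n : ℕ) : broom :=
  ⟨conePoint (-(1 / ((n : ℝ) + 1))) 0,
    conePoint_mem_broom (neg_one_div_mem_broomBase n) ⟨le_rfl, zero_le_one⟩⟩

theorem conePoint_zero_zero : conePoint 0 0 = 0 := plane_ext (by simp) (by simp)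

theorem prong_subset_left {n : ℕ} {p : broom} (hp : p ∈ prong n) : p.1 ∈ broomLeft := by
  rcases p.2 with h | h
  · exact h
  · exfalso
    have hb := broom_bounds p.2
    have h0 : 0 ≤ p.1 0 := by
      by_cases hz : p.1 = 0
      · rw [hz]; simp
      · exact (apply_zero_pos_of_mem_broomRight h hz).le
    have h1 : 0 < 1 / ((n : ℝ) + 1) * (1 - p.1 1) :=
      mul_pos (by positivity) (by linarith [hp.1])
    linarith [hp.2, hb.2.1]

theorem broomCenter_not_mem_prong (n : ℕ) : broomCenter ∉ prong n := by
  rintro ⟨-, h⟩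
  have : (0 : ℝ) < 1 / ((n : ℝ) + 1) := by positivity
  simp [broomCenter] at h
  have h2 : (0 : ℝ) < (n : ℝ) + 1 := by positivity
  linarith

theorem prongEnd_mem (n : ℕ) : prongEnd n ∈ prong n := by
  constructor <;> simp [prongEnd]

theorem tendsto_prongEnd : Tendsto prongEnd atTop (𝓝 broomCenter) := by
  rw [tendsto_subtype_rng]
  have h := (tendsto_one_div_add_atTop_nhds_zero_nat (𝕜 := ℝ)).neg
  rw [neg_zero] at h
  have hc : Continuous fun c : ℝ => conePoint c 0 := by unfold conePoint; fun_prop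
  have := (hc.tendsto 0).comp h
  rw [conePoint_zero_zero] at this
  exact this

theorem isOpen_prong (n : ℕ) : IsOpen (prong n) := by
  -- On the segment over the base point `c` one has `p 0 + p 1 = c * (1 - p 1)`. Reciprocals of
  -- half-integers separate the base point `-1 / (n + 1)` from all others.
  have : prong n = {p : broom | p.1 1 < 1} ∩
      ({p | p.1 0 + p.1 1 < -(1 / ((n : ℝ) + 3 / 2)) * (1 - p.1 1)} ∩
        {p | -(1 / ((n : ℝ) + 1 / 2)) * (1 - p.1 1) < p.1 0 + p.1 1}) := by
    ext p
    simp only [prong, mem_ofPred_eq, mem_inter_iff]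
    have e1 : 1 / ((n : ℝ) + 3 / 2) < 1 / ((n : ℝ) + 1) :=
      one_div_lt_one_div_of_lt (by positivity) (by linarith)
    have e2 : 1 / ((n : ℝ) + 1) < 1 / ((n : ℝ) + 1 / 2) :=
      one_div_lt_one_div_of_lt (by positivity) (by linarith)
    have e3 : 0 < 1 / ((n : ℝ) + 3 / 2) := by positivity
    refine and_congr_right fun hlt => ?_
    have hpos : 0 < 1 - p.1 1 := by linarith
    constructor
    · intro h
      rw [h]
      constructor <;> nlinarith
    · rintro ⟨h1, h2⟩
      rcases p.2 with hp | hp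
      · obtain ⟨c, hc, s, hs, hps⟩ := mem_broomLeft_iff.1 hp
        have k0 : p.1 0 = c - s * (1 + c) := by rw [hps]; rfl
        have k1 : p.1 1 = s := by rw [hps]; rfl
        rw [k0, k1] at h1 h2
        rw [k0, k1]
        rw [k1] at hpos
        have k2 : c - s * (1 + c) + s = c * (1 - s) := by ring
        rw [k2] at h1 h2 ⊢
        have h1' := lt_of_mul_lt_mul_right h1 hpos.le
        have h2' := lt_of_mul_lt_mul_right h2 hpos.le
        rcases hc with rfl | ⟨m, rfl⟩
        · linarith
        · have a1 : (m : ℝ) + 1 < n + 3 / 2 :=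
            lt_of_one_div_lt_one_div (by positivity) (by linarith)
          have a2 : (n : ℝ) + 1 / 2 < m + 1 :=
            lt_of_one_div_lt_one_div (by positivity) (by linarith)
          have a3 : m < n + 1 := by
            have : (m : ℝ) < (n + 1 : ℕ) := by push_cast; linarith
            exact_mod_cast this
          have a4 : n < m + 1 := by
            have : (n : ℝ) < (m + 1 : ℕ) := by push_cast; linarith
            exact_mod_cast this
          rw [show m = n by omega]
      · exfalso
        have hb := broom_bounds p.2
        have h0 : 0 ≤ p.1 0 := by
          by_cases hz : p.1 = 0
          · rw [hz]; simp
          · exact (apply_zero_pos_of_mem_broomRight hp hz).le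
        nlinarith [hb.2.1]
  rw [this]
  have c0 : Continuous fun p : broom => p.1 0 := by fun_prop
  have c1 : Continuous fun p : broom => p.1 1 := by fun_prop
  exact (isOpen_lt c1 continuous_const).inter
    ((isOpen_lt (c0.add c1) (continuous_const.mul (continuous_const.sub c1))).inter
      (isOpen_lt (continuous_const.mul (continuous_const.sub c1)) (c0.add c1)))

theorem isClosed_insert_prong (n : ℕ) : IsClosed (insert leftApex (prong n)) := by
  have : insert leftApex (prong n) =
      {p : broom | p.1 0 + p.1 1 = -(1 / ((n : ℝ) + 1)) * (1 - p.1 1)} := by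
    ext p
    simp only [mem_insert_iff, prong, mem_ofPred_eq]
    constructor
    · rintro (rfl | h)
      · simp [leftApex]
      · exact h.2
    · intro h
      rcases lt_or_eq_of_le (broom_bounds p.2).2.2 with h1 | h1
      · exact Or.inr ⟨h1, h⟩
      · refine Or.inl (Subtype.ext (plane_ext ?_ ?_))
        · rw [h1] at h
          simp [leftApex]
          linarith
        · simpa [leftApex] using h1
  rw [this]
  exact isClosed_eq (by fun_prop) (by fun_prop)

theorem isOpen_broomLeft_diff : IsOpen {p : broom | p.1 ∈ broomLeft ∧ p ≠ broomCenter} := by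
  have : {p : broom | p.1 ∈ broomLeft ∧ p ≠ broomCenter} = {p | p.1 0 < 0} := by
    ext p
    constructor
    · rintro ⟨h1, h2⟩
      exact apply_zero_neg_of_mem_broomLeft h1 fun h => h2 (Subtype.ext h)
    · intro h
      have hne : p.1 ≠ 0 := fun h' => by
        simp only [mem_ofPred_eq, h'] at h
        simp at h
      refine ⟨p.2.resolve_right fun hr => ?_, fun h' => hne (by rw [h']; rfl)⟩
      exact lt_asymm h (apply_zero_pos_of_mem_broomRight hr hne)
  rw [this]
  exact isOpen_lt (by fun_prop) continuous_const

/-! ### Attached brooms -/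

/-- An embedded broom in `Z` that is attached to the rest of the space at most at its center. -/
structure IsAttachedBroom {Z : Type} [TopologicalSpace Z] (e : broom → Z) : Prop where
  isEmbedding : IsEmbedding e
  isOpen : IsOpen (e '' {broomCenter}ᶜ)

namespace IsAttachedBroom

variable {Z : Type} [TopologicalSpace Z] {e : broom → Z}

/-- Allows statements about the left half to be transferred to the right half. -/
theorem comp_reflect (he : IsAttachedBroom e) : IsAttachedBroom (e ∘ broomReflect) where
  isEmbedding := he.isEmbedding.comp broomReflect.isEmbedding
  isOpen := by
    rw [image_comp]
    convert he.isOpen using 2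
    rw [image_compl_eq broomReflect.bijective, image_singleton, broomReflect_center]

theorem isOpen_image (he : IsAttachedBroom e) {O : Set broom} (hO : IsOpen O)
    (h : broomCenter ∉ O) : IsOpen (e '' O) := by
  obtain ⟨V, hV, rfl⟩ := he.isEmbedding.isOpen_iff.1 hO
  convert hV.inter he.isOpen using 1
  ext z
  constructor
  · rintro ⟨p, hp, rfl⟩
    exact ⟨hp, p, fun hc => h (by rw [← show p = broomCenter from hc]; exact hp), rfl⟩
  · rintro ⟨hz, p, -, rfl⟩
    exact ⟨p, hz, rfl⟩

theorem left_inter_right (he : IsAttachedBroom e) :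
    e '' {p | p.1 ∈ broomLeft} ∩ (e ∘ broomReflect) '' {p | p.1 ∈ broomLeft} ⊆ {e broomCenter} := by
  rintro _ ⟨⟨p, hp, rfl⟩, ⟨q, hq, hpq⟩⟩
  have h := he.isEmbedding.injective hpq
  have hr : p.1 ∈ broomRight := by
    rw [← h, mem_broomRight_iff]
    show reflectPlane (reflectPlane q.1) ∈ broomLeft
    rwa [reflectPlane_reflectPlane]
  exact congrArg e (Subtype.ext (broomLeft_inter_broomRight ⟨hp, hr⟩))

variable [T2Space Z]

/-- Each prong is open and its closure adds at most the apex, so a connected set that avoids the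
apex is contained in the prong or misses it. -/
theorem isProngSystem (he : IsAttachedBroom e) :
    IsProngSystem (e broomCenter) {e leftApex}ᶜ (e '' {p | p.1 ∈ broomLeft})
      (fun n => e (prongEnd n)) (fun n => e '' prong n) where
  mem_nhds := by
    refine isClosed_singleton.isOpen_compl.mem_nhds fun h => ?_
    have := congrArg (fun p : broom => p.1 1) (he.isEmbedding.injective h)
    simp [broomCenter, leftApex] at this
  isClosed := ((isCompact_broomLeft.isClosed.preimage continuous_subtype_val).isCompact.image
    he.isEmbedding.continuous).isClosed
  tendsto := (he.isEmbedding.continuous.tendsto _).comp tendsto_prongEnd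
  mem n := ⟨_, prongEnd_mem n, rfl⟩
  subset n := image_mono fun p hp => prong_subset_left hp
  not_mem n := by
    rintro ⟨p, hp, h⟩
    rw [he.isEmbedding.injective h] at hp
    exact broomCenter_not_mem_prong n hp
  confine n S hS hSU hne := by
    have h1 : IsClosed (e '' insert leftApex (prong n)) :=
      ((isClosed_insert_prong n).isCompact.image he.isEmbedding.continuous).isClosed
    refine hS.subset_left_of_subset_union (he.isOpen_image (isOpen_prong n)
      (broomCenter_not_mem_prong n)) h1.isOpen_compl ?_ ?_ hne
    · rw [disjoint_compl_right_iff_subset]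
      exact image_mono (subset_insert _ _)
    · intro z hz
      by_cases h : z ∈ e '' insert leftApex (prong n)
      · obtain ⟨p, rfl | hp, rfl⟩ := h
        · exact absurd rfl (hSU hz)
        · exact Or.inl ⟨p, hp, rfl⟩
      · exact Or.inr h

theorem isProngSystem_right (he : IsAttachedBroom e) :
    IsProngSystem (e broomCenter) {e (broomReflect leftApex)}ᶜ
      ((e ∘ broomReflect) '' {p | p.1 ∈ broomLeft})
      (fun n => e (broomReflect (prongEnd n))) (fun n => (e ∘ broomReflect) '' prong n) := by
  have := he.comp_reflect.isProngSystem
  rwa [Function.comp_apply, broomReflect_center] at this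

/-- The prong systems of the two halves pin the center during the whole homotopy. Then the
confinement of the left prong ends applies up to time `1`. -/
theorem fixed_and_eventually (he : IsAttachedBroom e) {k : C(Z, Z)}
    (hk : k.Homotopic (ContinuousMap.id Z)) :
    k (e broomCenter) = e broomCenter ∧ ∀ᶠ n in atTop, k (e (prongEnd n)) ∈ e '' prong n := by
  obtain ⟨H⟩ := hk.symm
  let h : ℝ × Z → Z := fun q => H (projIcc 0 1 zero_le_one q.1, q.2)
  have hh : Continuous h := by
    refine H.continuous.comp (Continuous.prodMk ?_ continuous_snd)
    exact continuous_projIcc.comp continuous_fst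
  have h0 : ∀ z, h (0, z) = z := fun z => by
    simp only [h, projIcc_left]; exact H.apply_zero z
  have h1 : ∀ z, h (1, z) = k z := fun z => by
    simp only [h, projIcc_right]; exact H.apply_one z
  have hfix := he.isProngSystem.apply_eq_of_two he.isProngSystem_right he.left_inter_right
    isClosed_singleton hh h0 (T := 1)
  refine ⟨by rw [← h1]; exact hfix 1 ⟨zero_le_one, le_rfl⟩, ?_⟩
  filter_upwards [he.isProngSystem.eventually_forall_mem hh h0 zero_le_one (fun t ht => by
    rw [hfix t ht]
    exact mem_interior_iff_mem_nhds.2 he.isProngSystem.mem_nhds)] with n hn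
  rw [← h1]
  exact hn 1 ⟨zero_le_one, le_rfl⟩

theorem fixed (he : IsAttachedBroom e) {k : C(Z, Z)}
    (hk : k.Homotopic (ContinuousMap.id Z)) : k (e broomCenter) = e broomCenter :=
  (he.fixed_and_eventually hk).1

variable {X : Type} [TopologicalSpace X] {f : C(X, Z)} {g : C(Z, X)}

/-- The map `f` would send points close to `g (e broomCenter)`, the images of prong ends, into
prongs while sending `g (e broomCenter)` itself to the center. -/
theorem not_locally_connected (he : IsAttachedBroom e)
    (hfg : (f.comp g).Homotopic (ContinuousMap.id Z))
    (hloc : ∀ N ∈ 𝓝 (g (e broomCenter)), ∃ M ∈ 𝓝 (g (e broomCenter)), M ⊆ N ∧ IsPreconnected M) :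
    False := by
  obtain ⟨h1, h2⟩ := he.fixed_and_eventually hfg
  exact he.isProngSystem.not_mem_of_isPreconnected f.continuous h1
    ((g.continuous.tendsto _).comp he.isProngSystem.tendsto) h2 hloc

end IsAttachedBroom

/-- The parametrization of the left half of the broom by a cone. -/
noncomputable def broomCone (q : broomBase × ℝ) : broom :=
  ⟨conePoint q.1 (projIcc 0 1 zero_le_one q.2), conePoint_mem_broom q.1.2 (projIcc _ _ _ _).2⟩

theorem continuous_broomCone : Continuous broomCone := by
  refine Continuous.subtype_mk ?_ _
  have : Continuous fun q : broomBase × ℝ => ((projIcc (0 : ℝ) 1 zero_le_one q.2 : Icc (0 : ℝ) 1) : ℝ) :=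
    continuous_subtype_val.comp (continuous_projIcc.comp continuous_snd)
  unfold conePoint
  fun_prop

theorem broomCone_one (c : broomBase) : broomCone (c, 1) = leftApex := by
  refine Subtype.ext (plane_ext ?_ ?_) <;> simp [broomCone, leftApex]

theorem broomCone_eq {p : broom} (hp : p.1 ∈ broomLeft) :
    ∃ c : broomBase, p = broomCone (c, p.1 1) := by
  obtain ⟨c, hc, s, hs, h⟩ := mem_broomLeft_iff.1 hp
  refine ⟨⟨c, hc⟩, Subtype.ext ?_⟩
  have : p.1 1 = s := by rw [h]; rfl
  rw [this]
  simp only [broomCone, projIcc_of_mem zero_le_one hs]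
  exact h

instance : CompactSpace broomBase := isCompact_iff_compactSpace.1 isCompact_broomBase

theorem broomCone_apply_zero {c : broomBase} {s : ℝ} (hs : s ∈ Icc (0 : ℝ) 1) :
    (broomCone (c, s)).1 0 = c - s * (1 + c) := by
  simp [broomCone, projIcc_of_mem zero_le_one hs]

/-- The base points converge along with the points of the broom, away from the apex. -/
theorem tendsto_base_of_tendsto {c : ℕ → broomBase} {c₀ : broomBase} {p : ℕ → broom} {p₀ : broom}
    (hp : Tendsto p atTop (𝓝 p₀)) (h : ∀ᶠ n in atTop, p n = broomCone (c n, (p n).1 1))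
    (h0 : p₀ = broomCone (c₀, p₀.1 1)) (hlt : p₀.1 1 < 1) : Tendsto c atTop (𝓝 c₀) := by
  rw [tendsto_subtype_rng]
  -- The base point of a segment is a continuous function of the points on it, away from the apex.
  have key : ∀ {c : broomBase} {p : broom}, p = broomCone (c, p.1 1) → p.1 1 < 1 →
      (p.1 0 + p.1 1) / (1 - p.1 1) = c := by
    intro c p hp hlt
    have hb := broom_bounds p.2
    have : p.1 0 = c - p.1 1 * (1 + c) := by
      conv_lhs => rw [hp]
      exact broomCone_apply_zero hb.2
    rw [this, div_eq_iff (by linarith)]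
    ring
  have t0 : Tendsto (fun n => (p n).1 0) atTop (𝓝 (p₀.1 0)) :=
    ((show Continuous fun p : broom => p.1 0 by fun_prop).tendsto _).comp hp
  have t1 : Tendsto (fun n => (p n).1 1) atTop (𝓝 (p₀.1 1)) :=
    ((show Continuous fun p : broom => p.1 1 by fun_prop).tendsto _).comp hp
  rw [← key h0 hlt]
  refine Tendsto.congr' ?_ ((t0.add t1).div (tendsto_const_nhds.sub t1) (by linarith))
  filter_upwards [h, t1.eventually_lt_const hlt] with n hn hn'
  exact key hn hn'

namespace IsAttachedBroom

variable {Z : Type} [TopologicalSpace Z] [T2Space Z] {e : broom → Z} {X : Type} [TopologicalSpace X]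
  {f : C(X, Z)} {g : C(Z, X)} {e' : broom → X}

/-- A sequence converging to a point of an attached broom that is not the center lifts to the
broom. -/
theorem exists_tendsto_lift (he' : IsAttachedBroom e') {p : broom} (hp : p.1 ∈ broomLeft)
    (hpc : p ≠ broomCenter) {y : ℕ → X} (hy : Tendsto y atTop (𝓝 (e' p))) :
    ∃ (q : ℕ → broom) (c : ℕ → broomBase), Tendsto q atTop (𝓝 p) ∧
      ∀ᶠ n in atTop, e' (q n) = y n ∧ q n = broomCone (c n, (q n).1 1) := by
  have hopen := he'.isOpen_image isOpen_broomLeft_diff fun h => h.2 rfl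
  have hev := hy (hopen.mem_nhds ⟨p, ⟨hp, hpc⟩, rfl⟩)
  have hq : ∀ n, ∃ q : broom, ∃ c : broomBase,
      y n ∈ e' '' {p | p.1 ∈ broomLeft ∧ p ≠ broomCenter} → e' q = y n ∧ q = broomCone (c, q.1 1) := by
    intro n
    by_cases h : y n ∈ e' '' {p | p.1 ∈ broomLeft ∧ p ≠ broomCenter}
    · obtain ⟨q, hq, hq'⟩ := h
      obtain ⟨c, hc⟩ := broomCone_eq hq.1
      exact ⟨q, c, fun _ => ⟨hq', hc⟩⟩
    · exact ⟨p, ⟨0, Or.inl rfl⟩, fun h' => absurd h' h⟩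
  choose q c hqc using hq
  have hev' : ∀ᶠ n in atTop, e' (q n) = y n ∧ q n = broomCone (c n, (q n).1 1) := by
    filter_upwards [hev] with n hn using hqc n hn
  refine ⟨q, c, ?_, hev'⟩
  rw [he'.isEmbedding.tendsto_nhds_iff]
  exact hy.congr' (hev'.mono fun n hn => hn.1.symm)

/-- Otherwise the `g`-images of the prong ends of both halves converge to `p` within a half of `e'`,
which is a cone, and `f` sends them back into their prongs. This is the situation excluded by
`IsProngSystem.false_of_cone`, with the height of `p` as starting time. -/
theorem apply_center_ne_of_left (he : IsAttachedBroom e) (he' : IsAttachedBroom e')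
    (hfg : (f.comp g).Homotopic (ContinuousMap.id Z)) {p : broom} (hp : p.1 ∈ broomLeft)
    (hpc : p ≠ broomCenter) : g (e broomCenter) ≠ e' p := by
  intro hgp
  obtain ⟨h1, h2⟩ := he.fixed_and_eventually hfg
  have h2' := (he.comp_reflect.fixed_and_eventually hfg).2
  have hy : Tendsto (fun n => g (e (prongEnd n))) atTop (𝓝 (e' p)) := by
    rw [← hgp]
    exact (g.continuous.tendsto _).comp he.isProngSystem.tendsto
  have hy' : Tendsto (fun n => g (e (broomReflect (prongEnd n)))) atTop (𝓝 (e' p)) := by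
    rw [← hgp]
    exact (g.continuous.tendsto _).comp he.isProngSystem_right.tendsto
  obtain ⟨q, c, hq, hqc⟩ := he'.exists_tendsto_lift hp hpc hy
  obtain ⟨q', c', hq', hqc'⟩ := he'.exists_tendsto_lift hp hpc hy'
  obtain ⟨c₀, hc₀⟩ := broomCone_eq hp
  have ht : ∀ {q : ℕ → broom}, Tendsto q atTop (𝓝 p) →
      Tendsto (fun n => (q n).1 1) atTop (𝓝 (p.1 1)) := fun h =>
    ((show Continuous fun p : broom => p.1 1 by fun_prop).tendsto _).comp h
  let φ : broomBase × ℝ → Z := fun r => f (e' (broomCone r))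
  have hφ : Continuous φ := f.continuous.comp (he'.isEmbedding.continuous.comp continuous_broomCone)
  have hb := broom_bounds p.2
  have hfp : f (e' p) = e broomCenter := by rw [← hgp]; exact h1
  have hl : ∀ᶠ n in atTop, φ (c n, (q n).1 1) ∈ e '' prong n := by
    filter_upwards [hqc, h2] with n hn hn'
    simp only [φ]
    rw [← hn.2, hn.1]
    exact hn'
  have hr : ∀ᶠ n in atTop, φ (c' n, (q' n).1 1) ∈ (e ∘ broomReflect) '' prong n := by
    filter_upwards [hqc', h2'] with n hn hn'
    simp only [φ]
    rw [← hn.2, hn.1]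
    exact hn'
  have hapex : ∀ c c', φ (c, 1) = φ (c', 1) := fun c c' => by simp only [φ, broomCone_one]
  rcases lt_or_eq_of_le hb.2.2 with hlt | heq
  · refine he.isProngSystem.false_of_cone he.isProngSystem_right he.left_inter_right
      isClosed_singleton hφ (tendsto_base_of_tendsto hq (hqc.mono fun n hn => hn.2) hc₀ hlt)
      (ht hq) hb.2.2 ?_ (fun _ => hapex _ _) (n := id) hl
      fun _ => ⟨tendsto_base_of_tendsto hq' (hqc'.mono fun n hn => hn.2) hc₀ hlt, ht hq', hr⟩
    simp only [φ]
    rw [← hc₀, hfp]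
  -- At the apex the base points need not converge, so a subsequence is chosen. As the starting time
  -- is already `1`, the second prong system only has to supply vacuous data.
  · obtain ⟨c₁, φ₁, hmono, hc₁⟩ := CompactSpace.tendsto_subseq c
    refine he.isProngSystem.false_of_cone he.isProngSystem_right he.left_inter_right
      isClosed_singleton hφ hc₁ ((ht hq).comp hmono.tendsto_atTop) hb.2.2 ?_ (fun _ => hapex _ _)
      (n := φ₁) (hmono.tendsto_atTop.eventually hl) (c' := c') (s' := fun _ => 0)
      fun h => absurd h (not_lt.2 heq.ge)
    rw [heq, hapex c₁ c₀, ← heq]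
    simp only [φ]
    rw [← hc₀, hfp]

/-- If `f ∘ g` is homotopic to the identity, then `g` cannot map the center of an attached broom to
a point of an attached broom other than its center. -/
theorem apply_center_ne (he : IsAttachedBroom e) (he' : IsAttachedBroom e')
    (hfg : (f.comp g).Homotopic (ContinuousMap.id Z)) {p : broom} (hpc : p ≠ broomCenter) :
    g (e broomCenter) ≠ e' p := by
  rcases p.2 with hp | hp
  · exact he.apply_center_ne_of_left he' hfg hp hpc
  · have h := he.apply_center_ne_of_left he'.comp_reflect hfg (p := broomReflect p)
      (mem_broomRight_iff.1 hp) fun h => hpc (broomReflect.injective (h.trans broomReflect_center.symm))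
    have hp' : broomReflect (broomReflect p) = p := Subtype.ext (reflectPlane_reflectPlane p.1)
    rwa [Function.comp_apply, hp'] at h

end IsAttachedBroom

/-! ### Arcs through the center of an attached broom -/

/-- A continuous injection on an interval is strictly monotone, hence changes sign at an interior
zero. -/
theorem not_injOn_of_nonneg {w : ℝ → ℝ} {δ : ℝ} (hδ : 0 < δ) (hw : ContinuousOn w (Icc (-δ) δ))
    (hinj : InjOn w (Icc (-δ) δ)) (h0 : w 0 = 0) (hpos : ∀ t ∈ Icc (-δ) δ, 0 ≤ w t) : False := by
  have m0 : (0 : ℝ) ∈ Icc (-δ) δ := ⟨by linarith, hδ.le⟩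
  have m1 : δ ∈ Icc (-δ) δ := ⟨by linarith, le_rfl⟩
  have m2 : -δ ∈ Icc (-δ) δ := ⟨le_rfl, by linarith⟩
  rcases hw.strictMonoOn_of_injOn_Icc' (by linarith) hinj with h | h
  · have := h m2 m0 (by linarith)
    linarith [hpos _ m2]
  · have := h m0 m1 hδ
    linarith [hpos _ m1]

namespace IsAttachedBroom

variable {Z : Type} [TopologicalSpace Z] [T2Space Z] {e : broom → Z}

/-- Near the center the arc avoids the apex, so it cannot touch any prong. It is left with the
single segment from the center to the apex, of which the center is an end. -/
theorem false_of_arc_left (he : IsAttachedBroom e) {σ : ℝ → Z} (hσ : Continuous σ)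
    (h0 : σ 0 = e broomCenter) (hinj : InjOn σ (Ioo (-1) 1))
    (hleft : ∀ t ∈ Ioo (-1 : ℝ) 1, t ≠ 0 → σ t ∈ e '' {p | p.1 ∈ broomLeft ∧ p ≠ broomCenter}) :
    False := by
  have hN : σ ⁻¹' {e leftApex}ᶜ ∈ 𝓝 (0 : ℝ) :=
    hσ.continuousAt (by rw [h0]; exact he.isProngSystem.mem_nhds)
  obtain ⟨ε, hε, hball⟩ := Metric.mem_nhds_iff.1 hN
  set δ := min (ε / 2) (1 / 2)
  have hδ : 0 < δ := by positivity
  have hδ1 : δ ≤ 1 / 2 := min_le_right _ _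
  have hδε : δ ≤ ε / 2 := min_le_left _ _
  have hJ : ∀ t ∈ Icc (-δ) δ, t ∈ Ioo (-1 : ℝ) 1 := fun t ht => by
    constructor <;> linarith [ht.1, ht.2]
  have hJb : ∀ t ∈ Icc (-δ) δ, t ∈ σ ⁻¹' {e leftApex}ᶜ := fun t ht => hball (by
    rw [Real.ball_eq_Ioo]
    constructor <;> linarith [ht.1, ht.2])
  have hnp : ∀ t ∈ Icc (-δ) δ, ∀ n, σ t ∉ e '' prong n := by
    intro t ht n hn
    refine he.isProngSystem.not_mem n (he.isProngSystem.confine n (σ '' Icc (-δ) δ)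
      (isPreconnected_Icc.image _ hσ.continuousOn) (image_subset_iff.2 hJb) ⟨_, ⟨t, ht, rfl⟩, hn⟩
      ⟨0, ⟨by linarith, hδ.le⟩, h0⟩)
  have hlift : ∀ t, ∃ p : broom, t ∈ Icc (-δ) δ → e p = σ t ∧ p.1 ∈ broomLeft := by
    intro t
    by_cases ht : t ∈ Icc (-δ) δ
    · rcases eq_or_ne t 0 with rfl | h
      · exact ⟨broomCenter, fun _ => ⟨h0.symm, Or.inl (left_mem_segment _ _ _)⟩⟩
      · obtain ⟨p, hp, hp'⟩ := hleft t (hJ t ht) h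
        exact ⟨p, fun _ => ⟨hp', hp.1⟩⟩
    · exact ⟨broomCenter, fun h => absurd h ht⟩
  choose τ hτ using hlift
  have hcont : ContinuousOn τ (Icc (-δ) δ) := by
    rw [he.isEmbedding.isInducing.continuousOn_iff]
    exact hσ.continuousOn.congr fun t ht => (hτ t ht).1
  -- On the remaining segment the height determines the point and serves as an injective nonnegative
  -- coordinate.
  have hform : ∀ t ∈ Icc (-δ) δ, (τ t).1 = conePoint 0 ((τ t).1 1) := by
    intro t ht
    obtain ⟨c, hc, s, hs, h⟩ := mem_broomLeft_iff.1 (hτ t ht).2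
    have h1 : (τ t).1 1 = s := by rw [h]; rfl
    rw [h1]
    rcases hc with rfl | ⟨n, rfl⟩
    · exact h
    · exfalso
      rcases lt_or_eq_of_le hs.2 with hs1 | hs1
      · refine hnp t ht n ⟨τ t, ⟨h1.trans_lt hs1, ?_⟩, (hτ t ht).1⟩
        rw [h]
        simp only [conePoint_apply_zero, conePoint_apply_one]
        ring
      · refine hJb t ht ?_
        rw [mem_singleton_iff, ← (hτ t ht).1]
        congr 1
        refine Subtype.ext (h.trans ?_)
        rw [hs1]
        exact plane_ext (by simp [leftApex]) (by simp [leftApex])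
  refine not_injOn_of_nonneg hδ (w := fun t => (τ t).1 1)
    ((show Continuous fun p : broom => p.1 1 by fun_prop).comp_continuousOn hcont) ?_ ?_
    fun t ht => (broom_bounds (τ t).2).2.1
  · intro t ht t' ht' h
    have : τ t = τ t' := Subtype.ext (by rw [hform t ht, hform t' ht']; exact congrArg _ h)
    exact hinj (hJ t ht) (hJ t' ht') (by rw [← (hτ t ht).1, ← (hτ t' ht').1, this])
  · have : τ 0 = broomCenter := he.isEmbedding.injective
      ((hτ 0 ⟨by linarith, hδ.le⟩).1.trans h0)
    simp [this, broomCenter]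

/-- If an arc passes through the center of an attached broom and its two sides are joined outside
of the center, then the space is not an arc near the center outside of the broom. -/
theorem false_of_arc (he : IsAttachedBroom e) {σ : ℝ → Z} (hσ : Continuous σ)
    (h0 : σ 0 = e broomCenter) (hinj : InjOn σ (Ioo (-1) 1)) {S : Set Z} (hS : IsPreconnected S)
    (hcS : e broomCenter ∉ S) (hσS : ∀ t ∈ Ioo (-1 : ℝ) 1, t ≠ 0 → σ t ∈ S) {u : Z → ℝ}
    (hu : Continuous u) (hu0 : u (e broomCenter) = 0) {U : Set Z} (hU : U ∈ 𝓝 (e broomCenter))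
    (hupos : ∀ z ∈ U, z ∉ range e → 0 < u z) (huinj : InjOn u (U \ range e)) : False := by
  set A := e '' {p | p.1 ∈ broomLeft ∧ p ≠ broomCenter}
  set B := (e ∘ broomReflect) '' {p | p.1 ∈ broomLeft ∧ p ≠ broomCenter}
  have hA : IsOpen A := he.isOpen_image isOpen_broomLeft_diff fun h => h.2 rfl
  have hB : IsOpen B := he.comp_reflect.isOpen_image isOpen_broomLeft_diff fun h => h.2 rfl
  have hR : IsOpen (range e)ᶜ := (isCompact_range he.isEmbedding.continuous).isClosed.isOpen_compl
  have hAr : A ⊆ range e := image_subset_range _ _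
  have hBr : B ⊆ range e := (image_subset_range _ _).trans (range_comp_subset_range _ _)
  have hAB : Disjoint A B := by
    rw [Set.disjoint_left]
    rintro z ⟨p, hp, rfl⟩ ⟨q, hq, hpq⟩
    exact hp.2 (he.isEmbedding.injective
      (he.left_inter_right ⟨⟨p, hp.1, rfl⟩, ⟨q, hq.1, hpq⟩⟩))
  -- Without the center, the space is the disjoint union of three open sets: the two open halves and
  -- the outside of the broom. The connected set `S` lies in one of them.
  have hcover : S ⊆ A ∪ (B ∪ (range e)ᶜ) := by
    intro z hz
    by_cases hzr : z ∈ range e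
    · obtain ⟨p, rfl⟩ := hzr
      have hpc : p ≠ broomCenter := fun h => hcS (h ▸ hz)
      rcases p.2 with hp | hp
      · exact Or.inl ⟨p, ⟨hp, hpc⟩, rfl⟩
      · refine Or.inr (Or.inl ⟨broomReflect p, ⟨mem_broomRight_iff.1 hp, fun h => hpc
          (broomReflect.injective (h.trans broomReflect_center.symm))⟩, ?_⟩)
        exact congrArg e (Subtype.ext (reflectPlane_reflectPlane p.1))
    · exact Or.inr (Or.inr hzr)
  have hne : (S ∩ (A ∪ (B ∪ (range e)ᶜ))).Nonempty := by
    have := hσS (1 / 2) (by constructor <;> norm_num) (by norm_num)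
    exact ⟨_, this, hcover this⟩
  by_cases hSA : (S ∩ A).Nonempty
  · have := hS.subset_left_of_subset_union hA (hB.union hR) (Set.disjoint_union_right.2
      ⟨hAB, disjoint_compl_right_iff_subset.2 hAr⟩) hcover hSA
    exact he.false_of_arc_left hσ h0 hinj fun t ht h => this (hσS t ht h)
  have hcover' : S ⊆ B ∪ (range e)ᶜ := fun z hz =>
    (hcover hz).resolve_left fun h => hSA ⟨z, hz, h⟩
  by_cases hSB : (S ∩ B).Nonempty
  · have := hS.subset_left_of_subset_union hB hR (disjoint_compl_right_iff_subset.2 hBr)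
      hcover' hSB
    exact he.comp_reflect.false_of_arc_left hσ
      (by rw [h0, Function.comp_apply, broomReflect_center]) hinj fun t ht h => this (hσS t ht h)
  have hcover'' : ∀ z ∈ S, z ∉ range e := fun z hz =>
    (hcover' hz).resolve_left fun h => hSB ⟨z, hz, h⟩
  have hN : σ ⁻¹' U ∈ 𝓝 (0 : ℝ) := hσ.continuousAt (by rw [h0]; exact hU)
  obtain ⟨ε, hε, hball⟩ := Metric.mem_nhds_iff.1 hN
  set δ := min (ε / 2) (1 / 2)
  have hδ : 0 < δ := by positivity
  have hδ1 : δ ≤ 1 / 2 := min_le_right _ _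
  have hδε : δ ≤ ε / 2 := min_le_left _ _
  have hJ : ∀ t ∈ Icc (-δ) δ, t ∈ Ioo (-1 : ℝ) 1 := fun t ht => by
    constructor <;> linarith [ht.1, ht.2]
  have hJb : ∀ t ∈ Icc (-δ) δ, σ t ∈ U := fun t ht => hball (by
    rw [Real.ball_eq_Ioo]
    constructor <;> linarith [ht.1, ht.2])
  have hpos : ∀ t ∈ Icc (-δ) δ, t ≠ 0 → 0 < u (σ t) := fun t ht h =>
    hupos _ (hJb t ht) (hcover'' _ (hσS t (hJ t ht) h))
  -- In the last case the arc lies outside the broom except for the center, and `u` takes over the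
  -- role of the height.
  refine not_injOn_of_nonneg hδ (w := fun t => u (σ t)) (by fun_prop) ?_ (by simp only [h0, hu0]) ?_
  · intro t ht t' ht' h
    simp only at h
    rcases eq_or_ne t 0 with rfl | h1 <;> rcases eq_or_ne t' 0 with rfl | h2
    · rfl
    · have := hpos t' ht' h2
      rw [← h, h0, hu0] at this
      exact absurd this (lt_irrefl _)
    · have := hpos t ht h1
      rw [h, h0, hu0] at this
      exact absurd this (lt_irrefl _)
    · exact hinj (hJ t ht) (hJ t' ht') (huinj ⟨hJb t ht, hcover'' _ (hσS t (hJ t ht) h1)⟩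
        ⟨hJb t' ht', hcover'' _ (hσS t' (hJ t' ht') h2)⟩ h)
  · intro t ht
    rcases eq_or_ne t 0 with rfl | h
    · simp only [h0, hu0, le_refl]
    · exact (hpos t ht h).le

end IsAttachedBroom

/-! ### Compactness and connectedness of hairy disks -/

/-- The union of a compact set and of a sequence of compact sets that accumulate only at it. -/
theorem isCompact_union_iUnion {E : Type} [MetricSpace E] {K : Set E} (hK : IsCompact K)
    {L : ℕ → Set E} (hL : ∀ n, IsCompact (L n)) {r : ℕ → ℝ} (hr : Tendsto r atTop (𝓝 0))
    (hLK : ∀ n, ∀ x ∈ L n, ∃ y ∈ K, dist x y ≤ r n) : IsCompact (K ∪ ⋃ n, L n) := by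
  rw [isCompact_iff_ultrafilter_le_nhds]
  intro F hF
  by_cases hex : ∃ n, L n ∈ F
  · obtain ⟨n, hn⟩ := hex
    obtain ⟨x, hx, hFx⟩ := isCompact_iff_ultrafilter_le_nhds.1 (hL n) F (le_principal_iff.2 hn)
    exact ⟨x, Or.inr (mem_iUnion.2 ⟨n, hx⟩), hFx⟩
  · push Not at hex
    -- An ultrafilter that contains none of the sets `L n` contains the complement of any finite
    -- number of them, and all others are close to `K`.
    have hthick : ∀ ε > 0, Metric.thickening ε K ∈ F := by
      intro ε hε
      obtain ⟨N, hN⟩ := eventually_atTop.1 (hr.eventually_lt_const hε)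
      have h1 : (⋂ n ∈ Finset.range N, (L n)ᶜ) ∈ F :=
        (Filter.biInter_finset_mem _).2 fun n _ => Ultrafilter.compl_mem_iff_notMem.2 (hex n)
      filter_upwards [h1, le_principal_iff.1 hF] with x hx hx'
      rcases hx' with h | h
      · exact Metric.self_subset_thickening hε _ h
      · obtain ⟨n, hn⟩ := mem_iUnion.1 h
        have hNn : N ≤ n := by
          by_contra hlt
          exact mem_iInter₂.1 hx n (Finset.mem_range.2 (not_le.1 hlt)) hn
        obtain ⟨y, hy, hxy⟩ := hLK n x hn
        exact Metric.mem_thickening_iff.2 ⟨y, hy, hxy.trans_lt (hN n hNn)⟩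
    by_contra hcon
    push Not at hcon
    have hno : ∀ x ∈ K, ∃ U, IsOpen U ∧ x ∈ U ∧ U ∉ F := by
      intro x hx
      obtain ⟨U, hU, hUF⟩ := Filter.not_le.1 (hcon x (Or.inl hx))
      obtain ⟨V, hVU, hV, hxV⟩ := mem_nhds_iff.1 hU
      exact ⟨V, hV, hxV, fun h => hUF (mem_of_superset h hVU)⟩
    choose! U hU hxU hUF using hno
    obtain ⟨t, htK, ht⟩ := hK.elim_nhds_subcover U (fun x hx => (hU x hx).mem_nhds (hxU x hx))
    obtain ⟨δ, hδ, hδU⟩ := hK.exists_thickening_subset_open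
      (isOpen_biUnion fun x hx => hU x (htK x hx)) ht
    have h2 : (⋂ x ∈ t, (U x)ᶜ) ∈ F := (Filter.biInter_finset_mem _).2 fun x hx =>
      Ultrafilter.compl_mem_iff_notMem.2 (hUF x (htK x hx))
    obtain ⟨y, hy1, hy2⟩ := F.neBot.nonempty_of_mem (inter_mem (hthick δ hδ) h2)
    obtain ⟨x, hx, hyx⟩ := mem_iUnion₂.1 (hδU hy1)
    exact mem_iInter₂.1 hy2 x hx hyx

theorem isPreconnected_broomLeft : IsPreconnected broomLeft := by
  have h1 : conePoint 0 1 ∈ broomLeft :=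
    mem_broomLeft_iff.2 ⟨0, Or.inl rfl, 1, ⟨zero_le_one, le_rfl⟩, rfl⟩
  refine isPreconnected_of_forall (conePoint 0 1) fun p hp => ?_
  obtain ⟨c, hc, s, hs, rfl⟩ := mem_broomLeft_iff.1 hp
  refine ⟨conePoint c '' Icc 0 1, ?_, ⟨1, ⟨zero_le_one, le_rfl⟩, ?_⟩, ⟨s, hs, rfl⟩, ?_⟩
  · rintro _ ⟨t, ht, rfl⟩
    exact mem_broomLeft_iff.2 ⟨c, hc, t, ht, rfl⟩
  · exact plane_ext (by simp) (by simp)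
  · refine isPreconnected_Icc.image _ (Continuous.continuousOn ?_)
    unfold conePoint; fun_prop

theorem isPreconnected_broom : IsPreconnected broom := by
  have hr : broomRight = reflectPlane '' broomLeft := by
    ext p
    rw [mem_broomRight_iff]
    exact ⟨fun h => ⟨_, h, by simp⟩, by rintro ⟨q, hq, rfl⟩; simpa using hq⟩
  exact IsPreconnected.union 0 (Or.inl (left_mem_segment _ _ _)) (Or.inl (left_mem_segment _ _ _))
    isPreconnected_broomLeft
    (hr ▸ isPreconnected_broomLeft.image _ continuous_reflectPlane.continuousOn)

instance : PreconnectedSpace broom := isPreconnected_iff_preconnectedSpace.1 isPreconnected_broom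

namespace HairyDisk

variable (H : HairyDisk)

theorem isCompact_range_hair (i : ℕ) : IsCompact (range (H.hair i)) :=
  isCompact_range (H.isEmbedding_hair i).continuous

theorem m_mem_range (i : ℕ) : H.m i ∈ range (H.hair i) := ⟨_, H.hair_center i⟩

theorem m_mem_disk (i : ℕ) : H.m i ∈ Metric.closedBall (0 : Plane) 1 := by
  rw [mem_closedBall_zero_iff, H.norm_m]

/-- The set `J` of hairs is arbitrary because both the whole hairy disk and the disk with one hair
removed have to be closed. -/
theorem isCompact_disk_union (J : Set ℕ) :
    IsCompact (Metric.closedBall (0 : Plane) 1 ∪ ⋃ i, {q | i ∈ J ∧ q ∈ range (H.hair i)}) := by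
  refine isCompact_union_iUnion (isCompact_closedBall _ _) (fun i => ?_) H.tendsto_diam_hair
    fun i q hq => ⟨H.m i, H.m_mem_disk i,
      Metric.dist_le_diam_of_mem (H.isCompact_range_hair i).isBounded hq.2 (H.m_mem_range i)⟩
  by_cases hi : i ∈ J
  · have : {q | i ∈ J ∧ q ∈ range (H.hair i)} = range (H.hair i) := by
      ext q; simp only [mem_ofPred_eq, hi, true_and]
    rw [this]
    exact H.isCompact_range_hair i
  · convert isCompact_empty using 1
    ext q; simp [hi]

theorem isCompact_carrier : IsCompact H.carrier := by
  convert H.isCompact_disk_union univ using 1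
  ext q
  simp only [carrier, mem_union, mem_iUnion, mem_ofPred_eq, mem_univ, true_and]

/-- The part of a hairy disk that is left when the `i`-th hair is removed, except for its
center. -/
def shaved (i : ℕ) : Set Plane :=
  Metric.closedBall (0 : Plane) 1 ∪ ⋃ j, {q | j ∈ ({i}ᶜ : Set ℕ) ∧ q ∈ range (H.hair j)}

theorem isClosed_shaved (i : ℕ) : IsClosed (H.shaved i) := (H.isCompact_disk_union _).isClosed

theorem disk_subset_carrier : Metric.closedBall (0 : Plane) 1 ⊆ H.carrier := subset_union_left

theorem disk_subset_shaved (i : ℕ) : Metric.closedBall (0 : Plane) 1 ⊆ H.shaved i :=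
  subset_union_left

theorem hair_mem_carrier (i : ℕ) (p : broom) : H.hair i p ∈ H.carrier :=
  Or.inr (mem_iUnion.2 ⟨i, p, rfl⟩)

theorem zero_mem_carrier : (0 : Plane) ∈ H.carrier := H.disk_subset_carrier (by simp)

theorem mem_carrier_cases (i : ℕ) {q : Plane} (hq : q ∈ H.carrier) :
    q ∈ range (H.hair i) ∨ q ∈ H.shaved i := by
  rcases hq with h | h
  · exact Or.inr (Or.inl h)
  · obtain ⟨j, hj⟩ := mem_iUnion.1 h
    rcases eq_or_ne j i with rfl | hji
    · exact Or.inl hj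
    · exact Or.inr (Or.inr (mem_iUnion.2 ⟨j, hji, hj⟩))

theorem eq_center_of_hair_mem_disk {i : ℕ} {p : broom}
    (h : H.hair i p ∈ Metric.closedBall (0 : Plane) 1) : p = broomCenter := by
  have : H.hair i p ∈ ({H.m i} : Set Plane) := by
    rw [← H.hair_inter_disk i]; exact ⟨⟨p, rfl⟩, h⟩
  exact (H.isEmbedding_hair i).injective (Eq.trans this (H.hair_center i).symm)

theorem eq_center_of_hair_mem_shaved {i : ℕ} {p : broom} (h : H.hair i p ∈ H.shaved i) :
    p = broomCenter := by
  rcases h with h | h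
  · exact H.eq_center_of_hair_mem_disk h
  · obtain ⟨j, hj, hj'⟩ := mem_iUnion.1 h
    exact ((Set.disjoint_left.1 (H.disjoint_hair j i hj)) hj' ⟨p, rfl⟩).elim

theorem diam_pos : 0 < Metric.diam H.carrier := by
  have h1 := Metric.dist_le_diam_of_mem H.isCompact_carrier.isBounded H.zero_mem_carrier
    (H.disk_subset_carrier (H.m_mem_disk 0))
  rw [dist_zero_left, H.norm_m] at h1
  linarith

theorem norm_le_diam {q : Plane} (hq : q ∈ H.carrier) : ‖q‖ ≤ Metric.diam H.carrier := by
  have h1 := Metric.dist_le_diam_of_mem H.isCompact_carrier.isBounded H.zero_mem_carrier hq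
  rwa [dist_zero_left] at h1

theorem isPreconnected_carrier : IsPreconnected H.carrier := by
  have hball : IsPreconnected (Metric.closedBall (0 : Plane) 1) :=
    (convex_closedBall 0 1).isPreconnected
  refine isPreconnected_of_forall 0 fun q hq => ?_
  rcases hq with h | h
  · exact ⟨_, H.disk_subset_carrier, by simp, h, hball⟩
  · obtain ⟨i, hi⟩ := mem_iUnion.1 h
    refine ⟨Metric.closedBall 0 1 ∪ range (H.hair i), union_subset H.disk_subset_carrier ?_,
      Or.inl (by simp), Or.inr hi, IsPreconnected.union (H.m i) (H.m_mem_disk i) (H.m_mem_range i)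
        hball (isPreconnected_range (H.isEmbedding_hair i).continuous)⟩
    rintro _ ⟨p, rfl⟩
    exact H.hair_mem_carrier i p

open Classical in
/-- The retraction of a hairy disk to one of its hairs, followed by the inverse of the embedding
of the hair. -/
noncomputable def collapse (i : ℕ) (q : Plane) : broom :=
  if h : q ∈ range (H.hair i) then h.choose else broomCenter

theorem collapse_hair (i : ℕ) (p : broom) : H.collapse i (H.hair i p) = p := by
  have h : H.hair i p ∈ range (H.hair i) := ⟨p, rfl⟩
  rw [collapse, dif_pos h]
  exact (H.isEmbedding_hair i).injective h.choose_spec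

theorem collapse_of_mem_shaved {i : ℕ} {q : Plane} (hq : q ∈ H.shaved i) :
    H.collapse i q = broomCenter := by
  by_cases h : q ∈ range (H.hair i)
  · obtain ⟨p, rfl⟩ := h
    rw [collapse_hair, H.eq_center_of_hair_mem_shaved hq]
  · rw [collapse, dif_neg h]

/-- The hair and the rest of the hairy disk are closed and meet only in the center of the hair,
where the two definitions agree. -/
theorem continuousOn_collapse (i : ℕ) : ContinuousOn (H.collapse i) H.carrier := by
  have h1 : ContinuousOn (H.collapse i) (range (H.hair i)) := by
    rw [(H.isEmbedding_hair i).isInducing.continuousOn_iff]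
    refine continuousOn_id.congr ?_
    rintro _ ⟨p, rfl⟩
    simp [collapse_hair]
  have h2 : ContinuousOn (H.collapse i) (H.shaved i) :=
    continuousOn_const.congr fun q hq => H.collapse_of_mem_shaved hq
  exact (h1.union_of_isClosed h2 (H.isCompact_range_hair i).isClosed (H.isClosed_shaved i)).mono
    fun q hq => H.mem_carrier_cases i hq

end HairyDisk

/-! ### Coordinates in space -/

/-- The projection of space to the plane of the last two coordinates. -/
def planePart (p : Space) : Plane := !₂[p 1, p 2]

@[simp] theorem slice_apply_zero (x : ℝ) (q : Plane) : slice x q 0 = x := rfl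

@[simp] theorem planePart_slice (x : ℝ) (q : Plane) : planePart (slice x q) = q :=
  plane_ext rfl rfl

theorem space_ext {p q : Space} (h0 : p 0 = q 0) (h : planePart p = planePart q) : p = q := by
  ext i; fin_cases i
  · exact h0
  · exact congrArg (fun r : Plane => r 0) h
  · exact congrArg (fun r : Plane => r 1) h

@[simp] theorem planePart_smul (a : ℝ) (p : Space) : planePart (a • p) = a • planePart p :=
  plane_ext rfl rfl

@[simp] theorem planePart_add (p q : Space) : planePart (p + q) = planePart p + planePart q :=
  plane_ext rfl rfl

@[simp] theorem planePart_sub (p q : Space) : planePart (p - q) = planePart p - planePart q :=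
  plane_ext rfl rfl

@[simp] theorem planePart_zero : planePart 0 = 0 := plane_ext rfl rfl

@[fun_prop] theorem continuous_planePart : Continuous planePart := by
  unfold planePart; fun_prop

theorem Continuous.slice {A : Type} [TopologicalSpace A] {x : A → ℝ} {q : A → Plane}
    (hx : Continuous x) (hq : Continuous q) : Continuous fun a => slice (x a) (q a) := by
  unfold _root_.slice; fun_prop

theorem continuous_slice (x : ℝ) : Continuous (slice x) := continuous_const.slice continuous_id

theorem ContinuousOn.slice_const {A : Type} [TopologicalSpace A] {s : Set A} (x : ℝ) {q : A → Plane}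
    (hq : ContinuousOn q s) : ContinuousOn (fun a => slice x (q a)) s :=
  (continuous_slice x).comp_continuousOn hq

theorem norm_sq_space (p : Space) : ‖p‖ ^ 2 = p 0 ^ 2 + ‖planePart p‖ ^ 2 := by
  rw [EuclideanSpace.norm_sq_eq, EuclideanSpace.norm_sq_eq]
  simp [Fin.sum_univ_three, planePart]
  ring

theorem abs_apply_zero_le_norm (p : Space) : |p 0| ≤ ‖p‖ := by
  apply abs_le_of_sq_le_sq _ (norm_nonneg p)
  rw [norm_sq_space]; nlinarith [sq_nonneg ‖planePart p‖]

theorem norm_le_abs_add (p : Space) : ‖p‖ ≤ |p 0| + ‖planePart p‖ := by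
  apply le_of_sq_le_sq _ (by positivity)
  rw [norm_sq_space, add_sq, sq_abs]
  nlinarith [mul_nonneg (abs_nonneg (p 0)) (norm_nonneg (planePart p))]

theorem segment_slice_zero {a b : ℝ} (hab : a ≤ b) :
    segment ℝ (slice a 0) (slice b 0) = {p | planePart p = 0 ∧ p 0 ∈ Icc a b} := by
  rw [← segment_eq_Icc hab]
  ext p
  simp only [segment_eq_image, mem_image, mem_ofPred_eq]
  constructor
  · rintro ⟨t, ht, rfl⟩
    exact ⟨by simp, t, ht, rfl⟩
  · rintro ⟨h0, t, ht, h⟩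
    exact ⟨t, ht, space_ext h (by simp [h0])⟩

/-! ### The wedges in coordinates -/

/-- The first coordinates of the factors of the wedge. -/
def levels : Set ℝ := {x | ∃ k : ℕ, x = -(1 / ((k : ℝ) + 1))}

theorem levels_mem_Ico {x : ℝ} (hx : x ∈ levels) : x ∈ Ico (-1 : ℝ) 0 := by
  obtain ⟨k, rfl⟩ := hx
  have h1 : (1 : ℝ) / (k + 1) ≤ 1 := by
    rw [div_le_one (by positivity)]; linarith [k.cast_nonneg (α := ℝ)]
  have h2 : (0 : ℝ) < 1 / (k + 1) := by positivity
  constructor <;> linarith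

theorem neg_one_div_mem_levels (k : ℕ) : -(1 / ((k : ℝ) + 1)) ∈ levels := ⟨k, rfl⟩

/-- Levels are isolated from the points different from `0`. -/
theorem exists_isolated_level {x : ℝ} (hx : x < 0) :
    ∃ δ > 0, ∀ l ∈ levels, |l - x| < δ → l = x := by
  have hfin : {k : ℕ | -(1 / ((k : ℝ) + 1)) ≤ x / 2}.Finite := by
    refine (finite_Iic ⌈-(2 / x)⌉₊).subset fun k hk => ?_
    simp only [mem_ofPred_eq] at hk
    have h1 : -(x / 2) ≤ 1 / ((k : ℝ) + 1) := by linarith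
    have h2 : (0 : ℝ) < (k : ℝ) + 1 := by positivity
    rw [le_div_iff₀ h2] at h1
    have h3 : (k : ℝ) + 1 ≤ -(2 / x) := by
      rw [← neg_div, le_div_iff_of_neg hx]; linarith
    have h4 := Nat.le_ceil (-(2 / x))
    have h5 : (k : ℝ) ≤ ⌈-(2 / x)⌉₊ := by linarith
    exact_mod_cast h5
  have hcl : IsClosed ((fun k : ℕ => -(1 / ((k : ℝ) + 1))) '' {k : ℕ | -(1 / ((k : ℝ) + 1)) ≤ x / 2} \ {x}) :=
    ((hfin.image _).subset sdiff_subset).isClosed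
  obtain ⟨ε, hε, hball⟩ := Metric.isOpen_iff.1 hcl.isOpen_compl x (fun h => h.2 rfl)
  refine ⟨min ε (-x / 2), lt_min hε (by linarith), ?_⟩
  rintro l ⟨k, rfl⟩ hl
  by_contra hne
  have h1 := (lt_min_iff.1 hl).1
  have h2 := (lt_min_iff.1 hl).2
  refine hball (Metric.mem_ball.2 (by rwa [Real.dist_eq])) ⟨⟨k, ?_, rfl⟩, hne⟩
  simp only [mem_ofPred_eq]
  linarith [(abs_lt.1 h2).2]

/-- The sets of admissible first coordinates of points of the wedge: all negative numbers, possibly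
together with zero. -/
structure IsTail (T : Set ℝ) : Prop where
  Iio_subset : Iio 0 ⊆ T
  subset_Iic : T ⊆ Iic 0

theorem isTail_Iio : IsTail (Iio 0) := ⟨Subset.rfl, Iio_subset_Iic_self⟩

theorem isTail_Iic : IsTail (Iic 0) := ⟨Iio_subset_Iic_self, Subset.rfl⟩

theorem IsTail.mem_of_le {T : Set ℝ} (hT : IsTail T) {x y : ℝ} (hy : y ∈ T) (hxy : x ≤ y) :
    x ∈ T := by
  rcases (hxy.trans (hT.subset_Iic hy)).lt_or_eq with h | h
  · exact hT.Iio_subset h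
  · have := hT.subset_Iic hy
    rwa [show x = y from le_antisymm hxy (h ▸ this)]

theorem IsTail.convex {T : Set ℝ} (hT : IsTail T) : Convex ℝ T :=
  Set.OrdConnected.convex ⟨fun _ _ _ hy _ hz => hT.mem_of_le hy hz.2⟩

/-- The additional part of the wedge with a broom. -/
def broomTail : Set Space :=
  {p | (p 0 = -2 ∧ planePart p ∈ broom) ∨ (planePart p = 0 ∧ p 0 ∈ Icc (-2 : ℝ) (-1))}

namespace HairyDisk

variable (H : HairyDisk)

/-- The wedge of hairy disks, with the first coordinates of the points on the axis restricted
to `T`. -/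
def wedge (T : Set ℝ) : Set Space :=
  {p | (p 0 ∈ levels ∧ (-(Metric.diam H.carrier / p 0)) • planePart p ∈ H.carrier) ∨
    (planePart p = 0 ∧ -1 ≤ p 0 ∧ p 0 ∈ T)}

/-- The wedge of hairy disks together with an additional broom. -/
def broomWedge (T : Set ℝ) : Set Space := H.wedge T ∪ broomTail

/-- The similarity from the hairy disk to the `k`-th factor of the wedge. -/
noncomputable def place (k : ℕ) (q : Plane) : Space :=
  slice (-(1 / ((k : ℝ) + 1))) ((1 / (((k : ℝ) + 1) * Metric.diam H.carrier)) • q)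

theorem place_apply_zero (k : ℕ) (q : Plane) : H.place k q 0 = -(1 / ((k : ℝ) + 1)) := rfl

theorem planePart_place (k : ℕ) (q : Plane) :
    planePart (H.place k q) = (1 / (((k : ℝ) + 1) * Metric.diam H.carrier)) • q :=
  planePart_slice _ _

theorem scale_place (k : ℕ) (q : Plane) :
    (-(Metric.diam H.carrier / H.place k q 0)) • planePart (H.place k q) = q := by
  rw [planePart_place, place_apply_zero, smul_smul]
  have h1 := H.diam_pos.ne'
  have h2 : ((k : ℝ) + 1) ≠ 0 := by positivity
  have : -(Metric.diam H.carrier / -(1 / ((k : ℝ) + 1))) *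
    (1 / (((k : ℝ) + 1) * Metric.diam H.carrier)) = 1 := by field_simp
  rw [this, one_smul]

theorem place_scale {k : ℕ} {p : Space} (hp : p 0 = -(1 / ((k : ℝ) + 1))) :
    H.place k ((-(Metric.diam H.carrier / p 0)) • planePart p) = p := by
  refine space_ext (by rw [place_apply_zero, hp]) ?_
  rw [planePart_place, hp, smul_smul]
  have h1 := H.diam_pos.ne'
  have h2 : ((k : ℝ) + 1) ≠ 0 := by positivity
  have : (1 / (((k : ℝ) + 1) * Metric.diam H.carrier)) *
    -(Metric.diam H.carrier / -(1 / ((k : ℝ) + 1))) = 1 := by field_simp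
  rw [this, one_smul]

theorem continuous_place (k : ℕ) : Continuous (H.place k) :=
  (continuous_slice _).comp (continuous_const_smul _)

theorem place_injective (k : ℕ) : Function.Injective (H.place k) := fun q q' h => by
  rw [← H.scale_place k q, ← H.scale_place k q', h]

theorem place_mem_wedge (T : Set ℝ) (k : ℕ) {q : Plane} (hq : q ∈ H.carrier) :
    H.place k q ∈ H.wedge T :=
  Or.inl ⟨neg_one_div_mem_levels k, by rwa [scale_place]⟩

theorem mem_factor_iff {k : ℕ} {p : Space} : p ∈ H.factor k ↔
    p 0 = -(1 / ((k : ℝ) + 1)) ∧ (-(Metric.diam H.carrier / p 0)) • planePart p ∈ H.carrier := by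
  constructor
  · rintro ⟨q, hq, rfl⟩
    exact ⟨rfl, (H.scale_place k q).symm ▸ hq⟩
  · rintro ⟨h0, h⟩
    exact ⟨_, h, H.place_scale h0⟩

/-- The factor `-(diam / p 0)` undoes the scaling of the factor at level `p 0` without mentioning
its index, and the segments between consecutive centers fill the axis over `[-1, 0)`. -/
theorem WHo_eq : H.WHo = H.wedge (Iio 0) := by
  ext p
  simp only [WHo, mem_union, mem_iUnion, mem_factor_iff, wedge, mem_ofPred_eq]
  refine or_congr ⟨?_, ?_⟩ ?_
  · rintro ⟨k, h0, h⟩; exact ⟨⟨k, h0⟩, h⟩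
  · rintro ⟨⟨k, h0⟩, h⟩; exact ⟨k, h0, h⟩
  · have hseg : ∀ k : ℕ, segment ℝ (wedgePoint k) (wedgePoint (k + 1)) =
        {p | planePart p = 0 ∧ p 0 ∈ Icc (-(1 / ((k : ℝ) + 1))) (-(1 / (((k + 1 : ℕ) : ℝ) + 1)))} :=
      fun k => segment_slice_zero (neg_le_neg (one_div_le_one_div_of_le (by positivity)
        (by push_cast; linarith)))
    simp only [hseg, mem_ofPred_eq]
    constructor
    · rintro ⟨k, h, h1, h2⟩
      have h3 := levels_mem_Ico (neg_one_div_mem_levels k)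
      have h4 := levels_mem_Ico (neg_one_div_mem_levels (k + 1))
      exact ⟨h, h3.1.trans h1, h2.trans_lt h4.2⟩
    · rintro ⟨h, h1, h2⟩
      rw [mem_Iio] at h2
      have h3 : 1 ≤ -1 / p 0 := by rw [le_div_iff_of_neg h2]; linarith
      -- The segment containing `p` has index `⌊-1 / p 0⌋₊ - 1`, since the factors are numbered from
      -- `0`.
      have h4 : 1 ≤ ⌊-1 / p 0⌋₊ := Nat.one_le_floor_iff _ |>.2 h3
      obtain ⟨k, hk⟩ := Nat.exists_eq_add_of_le h4
      have h5 := Nat.floor_le (show 0 ≤ -1 / p 0 by linarith)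
      have h6 := Nat.lt_floor_add_one (-1 / p 0)
      rw [hk] at h5 h6
      push_cast at h5 h6
      refine ⟨k, h, ?_, ?_⟩
      · rw [le_div_iff_of_neg h2] at h5
        rw [neg_le, le_div_iff₀ (by positivity)]
        linarith
      · rw [div_lt_iff_of_neg h2] at h6
        rw [le_neg, div_le_iff₀ (by positivity)]
        push_cast
        linarith

theorem wedge_Iic_eq : H.wedge (Iic 0) = H.wedge (Iio 0) ∪ {0} := by
  ext p
  simp only [wedge, mem_union, mem_ofPred_eq, mem_singleton_iff, or_assoc]
  refine or_congr Iff.rfl ⟨?_, ?_⟩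
  · rintro ⟨h, h1, h2⟩
    rcases lt_or_eq_of_le (mem_Iic.1 h2) with h3 | h3
    · exact Or.inl ⟨h, h1, h3⟩
    · exact Or.inr (space_ext h3 (by rw [h, planePart_zero]))
  · rintro (⟨h, h1, h2⟩ | rfl)
    · exact ⟨h, h1, mem_Iic.2 (mem_Iio.1 h2).le⟩
    · simp

theorem WH_eq : H.WH = H.wedge (Iic 0) := by rw [WH, WHo_eq, wedge_Iic_eq]

theorem broomTail_eq :
    slice (-2) '' broom ∪ segment ℝ (slice (-2) 0) (wedgePoint 0) = broomTail := by
  rw [wedgePoint, segment_slice_zero (by norm_num)]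
  ext p
  simp only [broomTail, mem_union, mem_image, mem_ofPred_eq]
  refine or_congr ⟨?_, ?_⟩ (by norm_num)
  · rintro ⟨q, hq, rfl⟩
    exact ⟨rfl, by simpa using hq⟩
  · rintro ⟨h0, h⟩
    exact ⟨_, h, space_ext h0.symm (by simp)⟩

theorem WBHo_eq : H.WBHo = H.broomWedge (Iio 0) := by
  rw [WBHo, broomTail_eq, WHo_eq, union_comm, broomWedge]

theorem WBH_eq : H.WBH = H.broomWedge (Iic 0) := by
  rw [WBH, WBHo_eq, broomWedge, broomWedge, wedge_Iic_eq, union_right_comm]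

/-! ### Compactness, connectedness and local connectedness of the wedges -/

variable {H} {T : Set ℝ}

/-- A factor at level `x` has diameter `-x` and contains its center on the axis. So the wedge lies
in a cone with vertex at the origin, which makes its part near level `0` small. -/
theorem mem_wedge_bounds (hT : IsTail T) {p : Space} (hp : p ∈ H.wedge T) :
    -1 ≤ p 0 ∧ p 0 ≤ 0 ∧ ‖planePart p‖ ≤ -p 0 := by
  rcases hp with ⟨h0, h⟩ | ⟨h, h0, h1⟩
  · have h1 := levels_mem_Ico h0
    refine ⟨h1.1, h1.2.le, ?_⟩
    have h2 := H.norm_le_diam h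
    have hD := H.diam_pos
    have h3 := h1.2
    rw [norm_smul, norm_neg, norm_div, Real.norm_of_nonneg hD.le, Real.norm_of_nonpos h3.le,
      div_mul_eq_mul_div, div_le_iff₀ (by linarith)] at h2
    exact le_of_mul_le_mul_left h2 hD
  · have := hT.subset_Iic h1
    rw [mem_Iic] at this
    exact ⟨h0, this, by rw [h, norm_zero]; linarith⟩

theorem axis_mem_wedge (hT : IsTail T) {x : ℝ} (hx : x ∈ levels) : slice x 0 ∈ H.wedge T :=
  Or.inr ⟨by simp, (levels_mem_Ico hx).1, hT.Iio_subset (levels_mem_Ico hx).2⟩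

variable (H)

theorem isCompact_wedge : IsCompact (H.wedge (Iic 0)) := by
  have hseg : IsCompact {p : Space | planePart p = 0 ∧ p 0 ∈ Icc (-1 : ℝ) 0} := by
    have : {p : Space | planePart p = 0 ∧ p 0 ∈ Icc (-1 : ℝ) 0} = (fun x => slice x 0) '' Icc (-1) 0 := by
      ext p
      constructor
      · rintro ⟨h, h0⟩; exact ⟨p 0, h0, space_ext rfl (by simp [h])⟩
      · rintro ⟨x, hx, rfl⟩; exact ⟨by simp, hx⟩
    rw [this]
    exact isCompact_Icc.image (continuous_id.slice continuous_const)
  -- The points of a factor are within its diameter of its center, so the factors accumulate only at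
  -- the axis.
  have := isCompact_union_iUnion hseg (L := fun k => H.place k '' H.carrier)
    (fun k => H.isCompact_carrier.image (H.continuous_place k))
    (r := fun k => 1 / ((k : ℝ) + 1)) tendsto_one_div_add_atTop_nhds_zero_nat (by
      rintro k _ ⟨q, hq, rfl⟩
      have hb := mem_wedge_bounds isTail_Iic (H.place_mem_wedge (Iic 0) k hq)
      refine ⟨slice (H.place k q 0) 0, ⟨by simp, hb.1, hb.2.1⟩, ?_⟩
      rw [dist_eq_norm]
      refine (norm_le_abs_add _).trans ?_
      rw [planePart_sub, planePart_slice, sub_zero, PiLp.sub_apply, slice_apply_zero, sub_self,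
        abs_zero, zero_add]
      refine hb.2.2.trans ?_
      rw [place_apply_zero, neg_neg])
  have heq : H.wedge (Iic 0) = {p : Space | planePart p = 0 ∧ p 0 ∈ Icc (-1 : ℝ) 0} ∪
      ⋃ k, H.place k '' H.carrier := by
    ext p
    simp only [wedge, mem_union, mem_ofPred_eq, mem_iUnion]
    rw [or_comm]
    refine or_congr Iff.rfl ⟨?_, ?_⟩
    · rintro ⟨⟨k, h0⟩, h⟩
      exact ⟨k, _, h, H.place_scale h0⟩
    · rintro ⟨k, q, hq, rfl⟩
      exact ⟨neg_one_div_mem_levels k, by rwa [scale_place]⟩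
  rw [heq]
  exact this

theorem isCompact_broomTail : IsCompact broomTail := by
  rw [← broomTail_eq]
  refine (isCompact_broom.image (continuous_slice _)).union ?_
  rw [segment_eq_image]
  exact isCompact_Icc.image (by fun_prop)

theorem isCompact_broomWedge : IsCompact (H.broomWedge (Iic 0)) :=
  H.isCompact_wedge.union isCompact_broomTail

theorem convex_axis {T : Set ℝ} (hT : Convex ℝ T) : Convex ℝ {p : Space | planePart p = 0 ∧ p 0 ∈ T} := by
  rintro p ⟨h, h0⟩ q ⟨h', h0'⟩ a b ha hb hab
  exact ⟨by simp [h, h'], hT h0 h0' ha hb hab⟩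

/-- This part consists of an interval of the axis and of whole factors attached to it. It gives both
the connectedness of the wedge and small connected neighborhoods of the origin. -/
theorem isPreconnected_wedge_inter (hT : IsTail T) {a b : ℝ} (hab : a < b) (hb : b ∈ T)
    (hb1 : -1 ≤ b) : IsPreconnected (H.wedge T ∩ {p | a < p 0}) := by
  have hA : IsPreconnected {p : Space | planePart p = 0 ∧ p 0 ∈ Ici (-1) ∩ T ∩ Ioi a} :=
    (convex_axis (((convex_Ici _).inter hT.convex).inter (convex_Ioi _))).isPreconnected
  have hAs : {p : Space | planePart p = 0 ∧ p 0 ∈ Ici (-1) ∩ T ∩ Ioi a} ⊆ H.wedge T ∩ {p | a < p 0} :=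
    fun p hp => ⟨Or.inr ⟨hp.1, hp.2.1⟩, hp.2.2⟩
  refine isPreconnected_of_forall (slice b 0) fun p hp => ?_
  rcases hp.1 with ⟨⟨k, h0⟩, h⟩ | h
  · refine ⟨{p : Space | planePart p = 0 ∧ p 0 ∈ Ici (-1) ∩ T ∩ Ioi a} ∪ H.place k '' H.carrier,
      union_subset hAs ?_, Or.inl ⟨by simp, ⟨hb1, hb⟩, hab⟩, Or.inr ⟨_, h, H.place_scale h0⟩, ?_⟩
    · rintro _ ⟨q, hq, rfl⟩
      refine ⟨H.place_mem_wedge T k hq, ?_⟩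
      have := hp.2
      rw [mem_ofPred_eq, h0] at this
      exact this
    · refine IsPreconnected.union (slice (p 0) 0) ⟨by simp, ?_, hp.2⟩ ⟨0, H.zero_mem_carrier, ?_⟩ hA
        (H.isPreconnected_carrier.image _ (H.continuous_place k).continuousOn)
      · have := levels_mem_Ico (h0 ▸ neg_one_div_mem_levels k : p 0 ∈ levels)
        exact ⟨this.1, hT.Iio_subset this.2⟩
      · exact space_ext (by simp [place_apply_zero, h0]) (by simp [planePart_place])
  · exact ⟨_, hAs, ⟨by simp, ⟨hb1, hb⟩, hab⟩, ⟨h.1, h.2, hp.2⟩, hA⟩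

theorem isPreconnected_wedge (hT : IsTail T) : IsPreconnected (H.wedge T) := by
  have := H.isPreconnected_wedge_inter hT (a := -2) (b := -1) (by norm_num)
    (hT.Iio_subset (by norm_num)) le_rfl
  rwa [inter_eq_left.2 fun p hp => ?_] at this
  have := (mem_wedge_bounds hT hp).1
  show -2 < p 0
  linarith

theorem isPreconnected_broomWedge (hT : IsTail T) : IsPreconnected (H.broomWedge T) := by
  have h1 : slice (-1) 0 ∈ H.wedge T := axis_mem_wedge hT ⟨0, by norm_num⟩
  refine IsPreconnected.union (slice (-1) 0) h1 (Or.inr ⟨by simp, by norm_num⟩)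
    (H.isPreconnected_wedge hT) ?_
  rw [← broomTail_eq]
  exact IsPreconnected.union (slice (-2) 0) ⟨0, zero_mem_broom, rfl⟩ (left_mem_segment _ _ _)
    (isPreconnected_broom.image _ (continuous_slice _).continuousOn)
    (convex_segment _ _).isPreconnected

end HairyDisk

/-- Local connectedness at a point of a subspace of a metric space. -/
theorem exists_isPreconnected_nhds_subtype {E : Type} [MetricSpace E] {S : Set E} (x : S)
    (h : ∀ ε > 0, ∃ M ∈ 𝓝 (x : E), S ∩ M ⊆ Metric.ball (x : E) ε ∧ IsPreconnected (S ∩ M)) :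
    ∀ N ∈ 𝓝 x, ∃ M ∈ 𝓝 x, M ⊆ N ∧ IsPreconnected M := by
  intro N hN
  obtain ⟨N', hN', hsub⟩ := (mem_nhds_subtype S x N).1 hN
  obtain ⟨ε, hε, hball⟩ := Metric.mem_nhds_iff.1 hN'
  obtain ⟨M, hM, hMs, hMc⟩ := h ε hε
  refine ⟨Subtype.val ⁻¹' M, preimage_coe_mem_nhds_subtype.2 (mem_nhdsWithin_of_mem_nhds hM),
    fun y hy => hsub (hball (hMs ⟨y.2, hy⟩)), ?_⟩
  rw [← IsInducing.subtypeVal.isPreconnected_image, Subtype.image_preimage_coe]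
  exact hMc

namespace HairyDisk

variable (H : HairyDisk) {T : Set ℝ}

/-- A small ball about `x` meets no other level, and at the level of `x` it stays inside the disk.
If `x` is off the axis, the ball avoids the axis; if `x` is on the axis, segments from `x` to axis
points stay in it. So the trace of the wedge is star-shaped about `x`. -/
theorem exists_nhds_of_level (hT : IsTail T) {x : Space} (hx : x 0 ∈ levels)
    (hx1 : ‖(-(Metric.diam H.carrier / x 0)) • planePart x‖ < 1) {ε : ℝ} (hε : 0 < ε) :
    ∃ M ∈ 𝓝 x, H.wedge T ∩ M ⊆ Metric.ball x ε ∧ IsPreconnected (H.wedge T ∩ M) := by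
  have hx0 := levels_mem_Ico hx
  obtain ⟨δ, hδ, hiso⟩ := exists_isolated_level hx0.2
  set c := -(Metric.diam H.carrier / x 0)
  have h1 : ∀ᶠ p in 𝓝 x, ‖c • planePart p‖ < 1 :=
    (show Continuous fun p => ‖c • planePart p‖ by fun_prop).continuousAt.eventually_lt
      continuousAt_const hx1
  have h2 : ∀ᶠ p in 𝓝 x, planePart x ≠ 0 → planePart p ≠ 0 := by
    by_cases h : planePart x = 0
    · exact Eventually.of_forall fun p h' => absurd h h'
    · filter_upwards [continuous_planePart.continuousAt.eventually_ne h] with p hp _ using hp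
  obtain ⟨r, hr, hball⟩ := Metric.eventually_nhds_iff_ball.1 (h1.and h2)
  set ρ := min (min r δ) ε
  have hρ : 0 < ρ := lt_min (lt_min hr hδ) hε
  have hρr : ρ ≤ r := (min_le_left _ _).trans (min_le_left _ _)
  have hρδ : ρ ≤ δ := (min_le_left _ _).trans (min_le_right _ _)
  refine ⟨Metric.ball x ρ, Metric.ball_mem_nhds x hρ, fun p hp =>
    Metric.ball_subset_ball (min_le_right _ _) hp.2, ?_⟩
  have hcarr : ∀ p : Space, p 0 = x 0 → p ∈ Metric.ball x ρ → p ∈ H.wedge T := by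
    intro p hp hpb
    refine Or.inl ⟨hp ▸ hx, H.disk_subset_carrier ?_⟩
    rw [mem_closedBall_zero_iff, hp]
    exact (hball p (Metric.ball_subset_ball hρr hpb)).1.le
  have hxb : x ∈ Metric.ball x ρ := Metric.mem_ball_self hρ
  have hstar : StarConvex ℝ x (H.wedge T ∩ Metric.ball x ρ) := by
    rintro p ⟨hp, hpb⟩ a b ha hb hab
    have hyb : a • x + b • p ∈ Metric.ball x ρ := (convex_ball x ρ) hxb hpb ha hb hab
    refine ⟨?_, hyb⟩
    rcases hp with ⟨h0, -⟩ | ⟨h, h0, h0'⟩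
    · have hpx : p 0 = x 0 := by
        refine hiso _ h0 ?_
        rw [mem_ball_iff_norm] at hpb
        exact (abs_apply_zero_le_norm (p - x)).trans_lt (hpb.trans_le hρδ)
      refine hcarr _ ?_ hyb
      show a * x 0 + b * p 0 = x 0
      rw [hpx, ← add_mul, hab, one_mul]
    · have hxz : planePart x = 0 := by
        by_contra hne
        exact (hball p (Metric.ball_subset_ball hρr hpb)).2 hne h
      refine Or.inr (convex_axis ((convex_Ici (-1)).inter hT.convex) ⟨hxz, hx0.1, ?_⟩ ⟨h, h0, h0'⟩
        ha hb hab)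
      exact hT.Iio_subset hx0.2
  exact (hstar.isPathConnected ⟨hcarr x rfl hxb, hxb⟩).isConnected.isPreconnected

theorem exists_nhds_of_axis (hT : IsTail T) {x : Space} (hx : x 0 ∉ levels) (hx0 : x 0 < 0) {ε : ℝ}
    (hε : 0 < ε) :
    ∃ M ∈ 𝓝 x, H.wedge T ∩ M ⊆ Metric.ball x ε ∧ IsPreconnected (H.wedge T ∩ M) := by
  obtain ⟨δ, hδ, hiso⟩ := exists_isolated_level hx0
  set ρ := min δ ε
  have hρ : 0 < ρ := lt_min hδ hε
  refine ⟨Metric.ball x ρ, Metric.ball_mem_nhds x hρ, fun p hp =>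
    Metric.ball_subset_ball (min_le_right _ _) hp.2, ?_⟩
  have : H.wedge T ∩ Metric.ball x ρ =
      {p : Space | planePart p = 0 ∧ p 0 ∈ Ici (-1) ∩ T} ∩ Metric.ball x ρ := by
    ext p
    refine and_congr_left fun hpb => ⟨?_, fun h => Or.inr h⟩
    rintro (⟨h0, -⟩ | h)
    · refine absurd (hiso _ h0 ?_ ▸ h0) hx
      rw [mem_ball_iff_norm] at hpb
      exact (abs_apply_zero_le_norm (p - x)).trans_lt (hpb.trans_le (min_le_left _ _))
    · exact h
  rw [this]
  exact ((convex_axis ((convex_Ici _).inter hT.convex)).inter (convex_ball _ _)).isPreconnected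

theorem exists_nhds_of_zero (hT : IsTail T) (h0 : (0 : ℝ) ∈ T) {ε : ℝ} (hε : 0 < ε) :
    ∃ M ∈ 𝓝 (0 : Space), H.wedge T ∩ M ⊆ Metric.ball 0 ε ∧ IsPreconnected (H.wedge T ∩ M) := by
  refine ⟨{p | -(ε / 2) < p 0}, ?_, ?_, H.isPreconnected_wedge_inter hT (by linarith) h0
    (by norm_num)⟩
  · exact (isOpen_lt continuous_const (by fun_prop)).mem_nhds (by simpa using hε)
  · rintro p ⟨hp, hp0⟩
    rw [mem_ofPred_eq] at hp0
    have hb := mem_wedge_bounds hT hp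
    rw [mem_ball_zero_iff]
    refine (norm_le_abs_add p).trans_lt ?_
    rw [abs_of_nonpos hb.2.1]
    linarith [hb.2.2]

/-- The points of the wedge are of three types: points of the hairs, points of the boundaries of the
disks and points where the wedge is locally connected. -/
theorem wedge_cases (hT : IsTail T) (x : H.wedge T) :
    (∃ k i p, p ≠ broomCenter ∧ (x : Space) = H.place k (H.hair i p)) ∨
    (∃ k q, ‖q‖ = 1 ∧ (x : Space) = H.place k q) ∨
    ∀ N ∈ 𝓝 x, ∃ M ∈ 𝓝 x, M ⊆ N ∧ IsPreconnected M := by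
  obtain ⟨x, hx⟩ := x
  by_cases hl : x 0 ∈ levels
  · have hq : (-(Metric.diam H.carrier / x 0)) • planePart x ∈ H.carrier := by
      rcases hx with h | h
      · exact h.2
      · rw [h.1, smul_zero]; exact H.zero_mem_carrier
    obtain ⟨k, hk⟩ := hl
    have hpl := (H.place_scale hk).symm
    rcases lt_trichotomy ‖(-(Metric.diam H.carrier / x 0)) • planePart x‖ 1 with h | h | h
    · exact Or.inr (Or.inr (exists_isPreconnected_nhds_subtype _ fun ε hε =>
        H.exists_nhds_of_level hT ⟨k, hk⟩ h hε))
    · exact Or.inr (Or.inl ⟨k, _, h, hpl⟩)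
    · rcases hq with hq | hq
      · rw [mem_closedBall_zero_iff] at hq
        exact absurd h (not_lt.2 hq)
      · obtain ⟨i, p, hp⟩ := mem_iUnion.1 hq
        refine Or.inl ⟨k, i, p, ?_, by rw [hp]; exact hpl⟩
        rintro rfl
        rw [← hp, H.hair_center, H.norm_m] at h
        exact lt_irrefl _ h
  · obtain ⟨h, h0, h1⟩ := hx.resolve_left fun h => hl h.1
    refine Or.inr (Or.inr (exists_isPreconnected_nhds_subtype _ fun ε hε => ?_))
    rcases lt_or_eq_of_le (show x 0 ≤ 0 from hT.subset_Iic h1) with hlt | heq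
    · exact H.exists_nhds_of_axis hT hl hlt hε
    · have : x = 0 := space_ext heq (by rw [h, planePart_zero])
      subst this
      exact H.exists_nhds_of_zero hT h1 hε

/-! ### Attached brooms and fixed circles in the wedges -/

/-- The hairs of the factors of the wedge. -/
noncomputable def wedgeHair (T : Set ℝ) (k i : ℕ) (p : broom) : H.wedge T :=
  ⟨H.place k (H.hair i p), H.place_mem_wedge T k (H.hair_mem_carrier i p)⟩

theorem isAttachedBroom_wedgeHair (k i : ℕ) :
    IsAttachedBroom (H.wedgeHair T k i) where
  isEmbedding := by
    refine (Continuous.isClosedEmbedding ?_ ?_).isEmbedding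
    · exact ((H.continuous_place k).comp (H.isEmbedding_hair i).continuous).subtype_mk _
    · intro p q hpq
      exact (H.isEmbedding_hair i).injective (H.place_injective k (congrArg Subtype.val hpq))
  isOpen := by
    obtain ⟨δ, hδ, hiso⟩ := exists_isolated_level (levels_mem_Ico (neg_one_div_mem_levels k)).2
    set x := -(1 / ((k : ℝ) + 1))
    set c := -(Metric.diam H.carrier / x)
    -- Near its level, the hair without its center is where the rescaled point avoids the closed
    -- rest of the hairy disk. Axis points rescale to the center of the disk, hence are excluded
    -- too.
    have hopen : IsOpen ({p : Space | |p 0 - x| < δ} ∩ {p | c • planePart p ∈ (H.shaved i)ᶜ}) :=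
      (isOpen_lt (by fun_prop) continuous_const).inter
        ((H.isClosed_shaved i).isOpen_compl.preimage
          (continuous_planePart.const_smul c))
    convert hopen.preimage (continuous_subtype_val (p := (· ∈ H.wedge T))) using 1
    ext ⟨z, hz⟩
    constructor
    · rintro ⟨p, hp, hpz⟩
      have hpz' : H.place k (H.hair i p) = z := congrArg Subtype.val hpz
      subst hpz'
      refine ⟨?_, fun hs => hp (H.eq_center_of_hair_mem_shaved (i := i) ?_)⟩
      · simp only [mem_ofPred_eq, place_apply_zero]
        simpa [x] using hδ
      · have := H.scale_place k (H.hair i p)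
        rw [place_apply_zero] at this
        rwa [this] at hs
    · rintro ⟨h1, h2⟩
      simp only [mem_ofPred_eq] at h1 h2
      have hz' := hz
      rcases hz with ⟨h0, h⟩ | ⟨h, -⟩
      · have hzx : z 0 = x := hiso _ h0 h1
        have hpl := H.place_scale hzx
        rw [hzx] at h hpl
        obtain ⟨p, hp⟩ := (H.mem_carrier_cases i h).resolve_right h2
        refine ⟨p, ?_, Subtype.ext ?_⟩
        · rintro rfl
          exact h2 (H.disk_subset_shaved i (by
            show c • planePart z ∈ _
            rw [← hp, H.hair_center]; exact H.m_mem_disk i))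
        · show H.place k (H.hair i p) = z
          rw [hp]; exact hpl
      · exfalso
        rw [h, smul_zero] at h2
        exact h2 (H.disk_subset_shaved i (by simp))

/-- The additional broom of the wedge with a broom. -/
def tailHair (T : Set ℝ) (p : broom) : H.broomWedge T :=
  ⟨slice (-2) p, Or.inr (Or.inl ⟨rfl, by simp⟩)⟩

theorem mem_broomTail_of_lt (hT : IsTail T) {z : Space} (hz : z ∈ H.broomWedge T) (h : z 0 < -1) :
    z ∈ broomTail :=
  hz.resolve_left fun hw => by linarith [(mem_wedge_bounds hT hw).1]

theorem isAttachedBroom_tailHair (hT : IsTail T) : IsAttachedBroom (H.tailHair T) where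
  isEmbedding := by
    refine (Continuous.isClosedEmbedding ?_ ?_).isEmbedding
    · exact ((continuous_slice _).comp continuous_subtype_val).subtype_mk _
    · intro p q hpq
      have := congrArg (fun z : H.broomWedge T => planePart z.1) hpq
      simp only [tailHair, planePart_slice] at this
      exact Subtype.ext this
  isOpen := by
    have hopen : IsOpen ({p : Space | p 0 < -1} ∩ {p | planePart p ∈ ({0}ᶜ : Set Plane)}) :=
      (isOpen_lt (by fun_prop) continuous_const).inter
        (isClosed_singleton.isOpen_compl.preimage continuous_planePart)
    convert hopen.preimage (continuous_subtype_val (p := (· ∈ H.broomWedge T))) using 1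
    ext ⟨z, hz⟩
    constructor
    · rintro ⟨p, hp, hpz⟩
      have hpz' : slice (-2) p = z := congrArg Subtype.val hpz
      subst hpz'
      refine ⟨by norm_num, fun h => hp (Subtype.ext ?_)⟩
      simp only [planePart_slice] at h
      exact h
    · rintro ⟨h1, h2⟩
      rcases H.mem_broomTail_of_lt hT hz h1 with ⟨h0, h⟩ | ⟨h, -⟩
      · refine ⟨⟨_, h⟩, fun hc => h2 (congrArg Subtype.val hc), Subtype.ext ?_⟩
        exact space_ext h0.symm (by simp [tailHair])
      · exact absurd h h2

/-- The disks of the factors of the wedge. -/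
noncomputable def wedgePlace (T : Set ℝ) (k : ℕ) (q : H.carrier) : H.wedge T :=
  ⟨H.place k q, H.place_mem_wedge T k q.2⟩

theorem continuous_wedgePlace (k : ℕ) : Continuous (H.wedgePlace T k) :=
  ((H.continuous_place k).comp continuous_subtype_val).subtype_mk _

/-- Maps homotopic to the identity fix the boundaries of the disks. -/
theorem fixed_of_norm_eq_one {h : C(H.wedge T, H.wedge T)}
    (hh : h.Homotopic (ContinuousMap.id _)) (k : ℕ) {q : H.carrier} (hq : ‖(q : Plane)‖ = 1) :
    h (H.wedgePlace T k q) = H.wedgePlace T k q := by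
  -- The fixed points form a closed set that contains the hair centers, which are dense in the
  -- circle.
  have hcl : IsClosed {q : H.carrier | h (H.wedgePlace T k q) = H.wedgePlace T k q} :=
    isClosed_eq (h.continuous.comp (H.continuous_wedgePlace k)) (H.continuous_wedgePlace k)
  have hm : ∀ i, (⟨H.m i, H.disk_subset_carrier (H.m_mem_disk i)⟩ : H.carrier) ∈
      {q : H.carrier | h (H.wedgePlace T k q) = H.wedgePlace T k q} := by
    intro i
    have := (H.isAttachedBroom_wedgeHair k i).fixed hh
    have he : H.wedgeHair T k i broomCenter =
        H.wedgePlace T k ⟨H.m i, H.disk_subset_carrier (H.m_mem_disk i)⟩ :=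
      Subtype.ext (congrArg (H.place k) (H.hair_center i))
    rw [he] at this
    exact this
  refine hcl.closure_subset_iff.2 (range_subset_iff.2 hm) ?_
  rw [closure_subtype, ← range_comp]
  exact H.dense_m (mem_sphere_zero_iff_norm.2 hq)

/-- The standard parametrization of the unit circle. -/
noncomputable def circlePoint (t : ℝ) : Plane := !₂[Real.cos t, Real.sin t]

theorem norm_circlePoint (t : ℝ) : ‖circlePoint t‖ = 1 := by
  rw [← sq_eq_sq₀ (norm_nonneg _) zero_le_one, norm_sq_plane]
  simp [circlePoint]

theorem continuous_circlePoint : Continuous circlePoint := by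
  unfold circlePoint; fun_prop

theorem circlePoint_add_two_pi (t : ℝ) : circlePoint (t + 2 * Real.pi) = circlePoint t := by
  simp [circlePoint]

theorem eq_of_circlePoint_eq {s t : ℝ} (h : circlePoint s = circlePoint t)
    (hst : |s - t| < 2 * Real.pi) : s = t := by
  have h0 : Real.cos s = Real.cos t := congrArg (fun q : Plane => q 0) h
  have h1 : Real.sin s = Real.sin t := congrArg (fun q : Plane => q 1) h
  have hc : Real.cos (s - t) = 1 := by
    rw [Real.cos_sub, h0, h1]; nlinarith [Real.sin_sq_add_cos_sq t]
  have := (Real.cos_eq_one_iff_of_lt_of_lt (by linarith [(abs_lt.1 hst).1])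
    (abs_lt.1 hst).2).1 hc
  linarith

theorem exists_circlePoint {q : Plane} (hq : ‖q‖ = 1) : ∃ t, q = circlePoint t := by
  have h := norm_sq_plane q
  rw [hq] at h
  have hz : ‖(⟨q 0, q 1⟩ : ℂ)‖ = 1 := by
    rw [← sq_eq_sq₀ (norm_nonneg _) zero_le_one, Complex.sq_norm, Complex.normSq_mk]
    linarith
  have h2 := Complex.norm_mul_cos_arg (⟨q 0, q 1⟩ : ℂ)
  have h3 := Complex.norm_mul_sin_arg (⟨q 0, q 1⟩ : ℂ)
  rw [hz, one_mul] at h2 h3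
  exact ⟨_, plane_ext h2.symm h3.symm⟩

/-! ### Homotopy inequivalence -/

/-- The wedge of hairy disks is not homotopy equivalent to the wedge with an additional broom. -/
theorem not_homotopyEquivalent (hT : IsTail T) :
    ¬ HomotopyEquivalent (H.wedge T) (H.broomWedge T) := by
  rintro ⟨E⟩
  set f : C(H.wedge T, H.broomWedge T) := E.toFun
  set g : C(H.broomWedge T, H.wedge T) := E.invFun
  have hgf : (g.comp f).Homotopic (ContinuousMap.id _) := E.left_inv
  have hfg : (f.comp g).Homotopic (ContinuousMap.id _) := E.right_inv
  have he := H.isAttachedBroom_tailHair hT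
  rcases H.wedge_cases hT (g (H.tailHair T broomCenter)) with ⟨k, i, p, hp, h⟩ | ⟨k, q, hq, h⟩ | h
  · exact he.apply_center_ne (H.isAttachedBroom_wedgeHair k i) hfg hp (Subtype.ext h)
  · obtain ⟨θ, rfl⟩ := exists_circlePoint hq
    have hmem : ∀ t, circlePoint t ∈ H.carrier := fun t =>
      H.disk_subset_carrier (mem_closedBall_zero_iff.2 (norm_circlePoint t).le)
    -- The circle through `g b` is traversed with period `2` and passes through `g b` at time `0`.
    -- Thus `(-1, 1)` is an arc about this point and `(0, 2)` is the circle without it.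
    let ω : ℝ → H.wedge T := fun t => H.wedgePlace T k ⟨circlePoint (θ + Real.pi * t), hmem _⟩
    have hω : Continuous ω := (H.continuous_wedgePlace k).comp
      ((continuous_circlePoint.comp (by fun_prop)).subtype_mk _)
    have hfix : ∀ t, g (f (ω t)) = ω t := fun t =>
      H.fixed_of_norm_eq_one hgf k (norm_circlePoint _)
    have hinj : ∀ s t, |s - t| < 2 → f (ω s) = f (ω t) → s = t := by
      intro s t hst hs
      have h1 : ω s = ω t := by rw [← hfix s, ← hfix t, hs]
      have h2 := H.place_injective k (congrArg Subtype.val h1)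
      have h3 := eq_of_circlePoint_eq h2 (by
        rw [add_sub_add_left_eq_sub, ← mul_sub, abs_mul, abs_of_pos Real.pi_pos]
        nlinarith [Real.pi_pos])
      exact mul_left_cancel₀ Real.pi_ne_zero (add_left_cancel h3)
    have hper : ∀ t, ω (t + 2) = ω t := by
      intro t
      refine Subtype.ext (congrArg (H.place k) ?_)
      show circlePoint (θ + Real.pi * (t + 2)) = circlePoint (θ + Real.pi * t)
      rw [← circlePoint_add_two_pi (θ + Real.pi * t)]
      congr 1; ring
    have h0 : f (ω 0) = H.tailHair T broomCenter := by
      have : ω 0 = g (H.tailHair T broomCenter) := by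
        refine Subtype.ext (Eq.trans ?_ h.symm)
        show H.place k (circlePoint (θ + Real.pi * 0)) = _
        rw [mul_zero, add_zero]
      rw [this]
      exact he.fixed hfg
    -- Beyond the broom, the region `z 0 < -1` is an open segment of the axis, on which `z 0 + 2` is
    -- a positive injective coordinate.
    refine he.false_of_arc (σ := fun t => f (ω t)) (S := (fun t => f (ω t)) '' Ioo 0 2)
      (f.continuous.comp hω) h0 ?_ (isPreconnected_Ioo.image _ (f.continuous.comp hω).continuousOn)
      ?_ ?_ (u := fun z => z.1 0 + 2) (by fun_prop) ?_
      (U := {z | z.1 0 < -1}) ?_ ?_ ?_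
    · intro s hs t ht hst
      refine hinj s t ?_ hst
      rw [abs_lt]
      constructor <;> linarith [hs.1, hs.2, ht.1, ht.2]
    · rintro ⟨t, ht, ht0⟩
      have := hinj t 0 (by rw [sub_zero, abs_of_pos ht.1]; exact ht.2) (ht0.trans h0.symm)
      linarith [ht.1]
    · intro t ht hne
      rcases lt_or_gt_of_ne hne with hlt | hgt
      · refine ⟨t + 2, by constructor <;> linarith [ht.1], ?_⟩
        simp only [hper]
      · exact ⟨t, ⟨hgt, by linarith [ht.2]⟩, rfl⟩
    · simp [tailHair]
    · exact (isOpen_lt (by fun_prop) continuous_const).mem_nhds (by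
        simp only [mem_ofPred_eq, tailHair, slice_apply_zero]; norm_num)
    · rintro z hz hzr
      rcases H.mem_broomTail_of_lt hT z.2 hz with ⟨h0, h⟩ | ⟨h, h1, -⟩
      · refine absurd ⟨⟨_, h⟩, Subtype.ext (space_ext h0.symm ?_)⟩ hzr
        simp [tailHair]
      · rcases lt_or_eq_of_le h1 with h1 | h1
        · linarith
        · refine absurd ⟨broomCenter, Subtype.ext (space_ext h1 ?_)⟩ hzr
          simp [tailHair, h, broomCenter]
    · rintro z ⟨hz, hzr⟩ z' ⟨hz', hzr'⟩ hzz
      have key : ∀ z : H.broomWedge T, z.1 0 < -1 → z ∉ range (H.tailHair T) →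
          planePart z.1 = 0 := by
        intro z hz hzr
        rcases H.mem_broomTail_of_lt hT z.2 hz with ⟨h0, h⟩ | ⟨h, -⟩
        · refine absurd ⟨⟨_, h⟩, Subtype.ext (space_ext h0.symm ?_)⟩ hzr
          simp [tailHair]
        · exact h
      refine Subtype.ext (space_ext ?_ (by rw [key z hz hzr, key z' hz' hzr']))
      simpa using hzz
  · exact he.not_locally_connected hfg h

end HairyDisk

/-! ### Homotopy domination in both directions -/

theorem ContinuousOn.of_closed_cover {A B : Type} [TopologicalSpace A] [TopologicalSpace B]
    {f : A → B} {S C D : Set A} (hC : IsClosed C) (hD : IsClosed D) (hS : S ⊆ C ∪ D)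
    (hfC : ContinuousOn f (S ∩ C)) (hfD : ContinuousOn f (S ∩ D)) : ContinuousOn f S := by
  have key : ∀ {C : Set A}, IsClosed C → ContinuousOn f (S ∩ C) → ∀ x ∈ S,
      ContinuousWithinAt f (S ∩ C) x := by
    intro C hC hfC x hx
    by_cases hxC : x ∈ C
    · exact hfC x ⟨hx, hxC⟩
    · exact continuousWithinAt_of_notMem_closure fun h =>
        hxC (closure_minimal inter_subset_right hC h)
  intro x hx
  have := (key hC hfC x hx).union (key hD hfD x hx)
  rwa [← inter_union_distrib_left, inter_eq_left.2 hS] at this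

theorem homotopic_id_of_segment_subset {E : Type} [NormedAddCommGroup E] [NormedSpace ℝ E]
    {S : Set E} (h : C(S, S)) (hS : ∀ x : S, segment ℝ (h x : E) x ⊆ S) :
    h.Homotopic (ContinuousMap.id S) :=
  ⟨{ toFun := fun q => ⟨(1 - (q.1 : ℝ)) • (h q.2 : E) + (q.1 : ℝ) • (q.2 : E), hS q.2
        ⟨1 - q.1, q.1, by linarith [q.1.2.2], q.1.2.1, by ring, rfl⟩⟩
     continuous_toFun := by
       refine Continuous.subtype_mk ?_ _
       fun_prop
     map_zero_left := fun x => Subtype.ext (by simp)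
     map_one_left := fun x => Subtype.ext (by simp) }⟩

/-- A map between subspaces. -/
def ContinuousMap.ofContinuousOn {E : Type} [TopologicalSpace E] {S S' : Set E} (F : E → E)
    (hF : ContinuousOn F S) (hm : MapsTo F S S') : C(S, S') :=
  ⟨fun x => ⟨F x, hm x.2⟩, hF.domRestrict.subtype_mk _⟩

/-- The map which shifts every factor of the wedge to the next one. -/
noncomputable def shiftUp (p : Space) : Space := (1 / (1 - p 0)) • p

/-- The inverse of `shiftUp`. -/
noncomputable def shiftDown (p : Space) : Space := (1 / (1 + p 0)) • p

theorem shiftUp_apply_zero (p : Space) : shiftUp p 0 = p 0 / (1 - p 0) := by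
  simp [shiftUp]; ring

theorem shiftDown_apply_zero (p : Space) : shiftDown p 0 = p 0 / (1 + p 0) := by
  simp [shiftDown]; ring

theorem shiftDown_shiftUp {p : Space} (hp : p 0 ≤ 0) : shiftDown (shiftUp p) = p := by
  have h1 : 1 - p 0 ≠ 0 := by linarith
  rw [shiftDown, shiftUp_apply_zero, shiftUp, smul_smul]
  have : 1 / (1 + p 0 / (1 - p 0)) * (1 / (1 - p 0)) = 1 := by
    have h2 : 1 + p 0 / (1 - p 0) = 1 / (1 - p 0) := by field_simp; ring
    rw [h2]; field_simp
  rw [this, one_smul]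

theorem continuousOn_shiftUp : ContinuousOn shiftUp {p | p 0 ≤ 0} := by
  unfold shiftUp
  have hc : Continuous fun p : Space => 1 - p 0 := by fun_prop
  refine ContinuousOn.smul (continuousOn_const.div hc.continuousOn fun p hp => ?_) continuousOn_id
  simp only [mem_ofPred_eq] at hp
  linarith

theorem continuousOn_shiftDown : ContinuousOn shiftDown {p | -(1 / 2) ≤ p 0} := by
  unfold shiftDown
  have hc : Continuous fun p : Space => 1 + p 0 := by fun_prop
  refine ContinuousOn.smul (continuousOn_const.div hc.continuousOn fun p hp => ?_) continuousOn_id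
  simp only [mem_ofPred_eq] at hp
  linarith

theorem isClosed_axis (a b : ℝ) : IsClosed {p : Space | planePart p = 0 ∧ p 0 ∈ Icc a b} :=
  (isClosed_eq continuous_planePart continuous_const).inter
    (isClosed_Icc.preimage (by fun_prop : Continuous fun p : Space => p 0))

namespace HairyDisk

variable (H : HairyDisk) {T : Set ℝ}

/-- A homothety about the origin does not change `planePart p` divided by `p 0`, which is all that
matters within a level. On levels, `x / (1 - x)` takes `-1 / n` to `-1 / (n + 1)`. -/
theorem shiftUp_mem_wedge (hT : IsTail T) {p : Space} (hp : p ∈ H.wedge T) :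
    shiftUp p ∈ H.wedge T := by
  have hb := mem_wedge_bounds hT hp
  have h1 : 0 < 1 - p 0 := by linarith [hb.2.1]
  rcases hp with ⟨⟨k, h0⟩, h⟩ | ⟨h, h0, hT'⟩
  · left
    have h2 : (0 : ℝ) < (k : ℝ) + 1 := by positivity
    refine ⟨⟨k + 1, ?_⟩, ?_⟩
    · have h3 : 1 - -(1 / ((k : ℝ) + 1)) = ((k : ℝ) + 1 + 1) / (k + 1) := by field_simp; ring
      rw [shiftUp_apply_zero, h0, h3]
      push_cast
      field_simp
    · rw [shiftUp_apply_zero, shiftUp, planePart_smul, smul_smul]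
      convert h using 2
      have h5 : p 0 ≠ 0 := by rw [h0]; exact neg_ne_zero.2 (by positivity)
      field_simp
  · right
    refine ⟨by rw [shiftUp, planePart_smul, h, smul_zero], ?_, ?_⟩
    · rw [shiftUp_apply_zero, le_div_iff₀ h1]; linarith
    · rcases lt_or_eq_of_le hb.2.1 with h2 | h2
      · refine hT.Iio_subset ?_
        rw [shiftUp_apply_zero]
        exact div_neg_of_neg_of_pos h2 h1
      · rw [shiftUp_apply_zero, h2, zero_div, ← h2]; exact hT'

theorem shiftDown_mem_wedge (hT : IsTail T) {p : Space} (hp : p ∈ H.wedge T)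
    (hp2 : -(1 / 2) ≤ p 0) : shiftDown p ∈ H.wedge T := by
  have hb := mem_wedge_bounds hT hp
  have h1 : 0 < 1 + p 0 := by linarith
  rcases hp with ⟨⟨k, h0⟩, h⟩ | ⟨h, h0, hT'⟩
  · left
    obtain _ | k := k
    · rw [h0] at hp2; norm_num at hp2
    have h2 : (0 : ℝ) < (k : ℝ) + 1 := by positivity
    have h3 : (0 : ℝ) < (k : ℝ) + 1 + 1 := by positivity
    push_cast at h0
    refine ⟨⟨k, ?_⟩, ?_⟩
    · rw [shiftDown_apply_zero, h0]
      have h4 : 1 + -(1 / ((k : ℝ) + 1 + 1)) = ((k : ℝ) + 1) / (k + 1 + 1) := by field_simp; ring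
      rw [h4]
      field_simp
    · rw [shiftDown_apply_zero, shiftDown, planePart_smul, smul_smul]
      convert h using 2
      have h5 : p 0 ≠ 0 := by rw [h0]; exact neg_ne_zero.2 (by positivity)
      field_simp
  · right
    refine ⟨by rw [shiftDown, planePart_smul, h, smul_zero], ?_, ?_⟩
    · rw [shiftDown_apply_zero, le_div_iff₀ h1]; linarith
    · rcases lt_or_eq_of_le hb.2.1 with h2 | h2
      · refine hT.Iio_subset ?_
        rw [shiftDown_apply_zero]
        exact div_neg_of_neg_of_pos h2 h1
      · rw [shiftDown_apply_zero, h2, zero_div, ← h2]; exact hT'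

theorem broomTail_bounds {p : Space} (hp : p ∈ broomTail) : -2 ≤ p 0 ∧ p 0 ≤ -1 := by
  rcases hp with h | h
  · constructor <;> linarith [h.1]
  · exact h.2

open Classical in
/-- The retraction of the wedge with a broom to the wedge. -/
noncomputable def retractTail (p : Space) : Space := if p ∈ broomTail then slice (-1) 0 else p

theorem eq_of_mem_wedge_of_mem_broomTail (hT : IsTail T) {p : Space} (hp : p ∈ H.wedge T)
    (hp' : p ∈ broomTail) : p = slice (-1) 0 := by
  have hb := mem_wedge_bounds hT hp
  rcases hp' with h | h
  · linarith [h.1, hb.1]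
  · exact space_ext (le_antisymm h.2.2 hb.1) (by simp [h.1])

theorem retractTail_of_mem_wedge (hT : IsTail T) {p : Space} (hp : p ∈ H.wedge T) :
    retractTail p = p := by
  by_cases h : p ∈ broomTail
  · rw [retractTail, if_pos h, H.eq_of_mem_wedge_of_mem_broomTail hT hp h]
  · rw [retractTail, if_neg h]

theorem isClosed_Ici_apply_zero (a : ℝ) : IsClosed {p : Space | a ≤ p 0} :=
  isClosed_le continuous_const (by fun_prop)

theorem broomWedge_subset (hT : IsTail T) : H.broomWedge T ⊆ broomTail ∪ {p | -1 ≤ p 0} := by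
  rintro p (hp | hp)
  · exact Or.inr (mem_wedge_bounds hT hp).1
  · exact Or.inl hp

theorem mem_wedge_of_le (hT : IsTail T) {p : Space} (hp : p ∈ H.broomWedge T) (h : -1 ≤ p 0) :
    p ∈ H.wedge T := by
  rcases hp with hp | hp
  · exact hp
  · have h1 := broomTail_bounds hp
    rcases hp with hp | hp
    · linarith [hp.1]
    · exact Or.inr ⟨hp.1, h, hT.Iio_subset (by rw [mem_Iio]; linarith)⟩

/-- The tail is closed and meets the wedge in one point, so collapsing it to that point is a
retraction, and no homotopy is needed. -/
theorem homotopyDominated_wedge_broomWedge (hT : IsTail T) :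
    HomotopyDominated (H.wedge T) (H.broomWedge T) := by
  have hcont : ContinuousOn retractTail (H.broomWedge T) := by
    refine ContinuousOn.of_closed_cover isCompact_broomTail.isClosed (isClosed_Ici_apply_zero (-1))
      (H.broomWedge_subset hT) ?_ ?_
    · exact continuousOn_const.congr fun p hp => if_pos hp.2
    · exact continuousOn_id.congr fun p hp =>
        H.retractTail_of_mem_wedge hT (H.mem_wedge_of_le hT hp.1 hp.2)
  have hmaps : MapsTo retractTail (H.broomWedge T) (H.wedge T) := by
    intro p hp
    by_cases h : p ∈ broomTail
    · rw [retractTail, if_pos h]; exact axis_mem_wedge hT ⟨0, by norm_num⟩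
    · rw [retractTail, if_neg h]; exact hp.resolve_right h
  refine ⟨⟨inclusion subset_union_left, continuous_inclusion _⟩,
    ContinuousMap.ofContinuousOn retractTail hcont hmaps, ?_⟩
  convert! ContinuousMap.Homotopic.refl _
  exact ContinuousMap.ext fun p => Subtype.ext (H.retractTail_of_mem_wedge hT p.2).symm

open Classical in
/-- The extension of the embedding of a hair to the plane. -/
noncomputable def hairExt (i : ℕ) (q : Plane) : Plane :=
  if h : q ∈ broom then H.hair i ⟨q, h⟩ else 0

theorem hairExt_of_mem (i : ℕ) {q : Plane} (h : q ∈ broom) :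
    H.hairExt i q = H.hair i ⟨q, h⟩ := dif_pos h

theorem continuousOn_hairExt (i : ℕ) : ContinuousOn (H.hairExt i) broom := by
  rw [continuousOn_iff_continuous_domRestrict]
  convert! (H.isEmbedding_hair i).continuous using 1
  ext1 q
  exact H.hairExt_of_mem i q.2

/-- The path from the center of the first hair of the first factor to the center of the second
factor by way of the center of the first factor, with parameters in `[-2, -1]`. -/
noncomputable def centerPath (x : ℝ) : Space :=
  slice (-1 + max 0 (x + 3 / 2)) ((max 0 (-3 - 2 * x) / Metric.diam H.carrier) • H.m 0)

theorem continuous_centerPath : Continuous H.centerPath := by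
  unfold centerPath
  exact Continuous.slice (by fun_prop) (by fun_prop)

theorem place_zero_eq (q : Plane) :
    H.place 0 q = slice (-1) ((1 / Metric.diam H.carrier) • q) := by
  simp [place]

open Classical in
/-- The map from the wedge with a broom to the wedge that shifts the factors and embeds the broom
as a hair of the first factor. -/
noncomputable def pushTail (p : Space) : Space :=
  if -1 ≤ p 0 then shiftUp p else if p 0 = -2 then H.place 0 (H.hairExt 0 (planePart p))
    else H.centerPath (p 0)

open Classical in
/-- The map from the wedge to the wedge with a broom that collapses the first factor to a broom and
shifts the other factors. -/
noncomputable def pullTail (p : Space) : Space :=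
  if -(1 / 2) ≤ p 0 then shiftDown p else if p 0 = -1 then
    slice (-2) (H.collapse 0 (Metric.diam H.carrier • planePart p)) else slice (2 * p 0) 0

theorem pushTail_of_axis {p : Space} (h : planePart p = 0) (hp : p 0 ∈ Icc (-2 : ℝ) (-1)) :
    H.pushTail p = H.centerPath (p 0) := by
  rcases eq_or_lt_of_le hp.2 with h1 | h1
  · rw [pushTail, if_pos h1.ge, h1]
    refine space_ext ?_ ?_
    · rw [shiftUp_apply_zero, h1]; norm_num [centerPath]
    · simp only [shiftUp, planePart_smul, h, centerPath, planePart_slice, smul_zero]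
      norm_num
  · rw [pushTail, if_neg (not_le.2 h1)]
    by_cases h2 : p 0 = -2
    · rw [if_pos h2, h, H.hairExt_of_mem 0 zero_mem_broom, h2, place_zero_eq]
      have : H.hair 0 ⟨0, zero_mem_broom⟩ = H.m 0 := H.hair_center 0
      rw [this]
      norm_num [centerPath]
    · rw [if_neg h2]

theorem pushTail_of_broom {p : Space} (h : planePart p ∈ broom) (hp : p 0 = -2) :
    H.pushTail p = H.place 0 (H.hair 0 ⟨planePart p, h⟩) := by
  rw [pushTail, if_neg (by rw [hp]; norm_num), if_pos hp, H.hairExt_of_mem 0 h]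

theorem pushTail_of_wedge (hT : IsTail T) {p : Space} (hp : p ∈ H.wedge T) :
    H.pushTail p = shiftUp p := if_pos (mem_wedge_bounds hT hp).1

theorem centerPath_mem_wedge (hT : IsTail T) {x : ℝ} (hx : x ∈ Icc (-2 : ℝ) (-1)) :
    H.centerPath x ∈ H.wedge T := by
  -- The path runs along a radius of the first disk until `-3 / 2`, then along the axis from level
  -- `-1` to level `-1 / 2`.
  rcases le_total x (-3 / 2) with h | h
  · have h1 : max 0 (x + 3 / 2) = 0 := max_eq_left (by linarith)
    have h2 : max 0 (-3 - 2 * x) = -3 - 2 * x := max_eq_right (by linarith)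
    have h3 : H.centerPath x = H.place 0 ((-3 - 2 * x) • H.m 0) := by
      rw [centerPath, h1, h2, place_zero_eq, smul_smul]
      congr 2
      · ring
      · ring
    rw [h3]
    refine H.place_mem_wedge T 0 (H.disk_subset_carrier ?_)
    rw [mem_closedBall_zero_iff, norm_smul, H.norm_m, mul_one, Real.norm_of_nonneg (by linarith)]
    linarith [hx.1]
  · have h1 : max 0 (x + 3 / 2) = x + 3 / 2 := max_eq_right (by linarith)
    have h2 : max 0 (-3 - 2 * x) = 0 := max_eq_left (by linarith)
    rw [centerPath, h1, h2, zero_div, zero_smul]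
    refine Or.inr ⟨by simp, ?_, hT.Iio_subset ?_⟩
    · rw [slice_apply_zero]; linarith
    · rw [slice_apply_zero, mem_Iio]; linarith [hx.2]

theorem mapsTo_pushTail (hT : IsTail T) : MapsTo H.pushTail (H.broomWedge T) (H.wedge T) := by
  rintro p (hp | hp | hp)
  · rw [H.pushTail_of_wedge hT hp]; exact H.shiftUp_mem_wedge hT hp
  · rw [H.pushTail_of_broom hp.2 hp.1]
    exact H.place_mem_wedge T 0 (H.hair_mem_carrier _ _)
  · rw [H.pushTail_of_axis hp.1 hp.2]; exact H.centerPath_mem_wedge hT hp.2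

theorem isClosed_broomSlice : IsClosed {p : Space | p 0 = -2 ∧ planePart p ∈ broom} :=
  (isClosed_eq (by fun_prop) continuous_const).inter
    (isCompact_broom.isClosed.preimage continuous_planePart)

theorem continuousOn_pushTail (hT : IsTail T) : ContinuousOn H.pushTail (H.broomWedge T) := by
  refine ContinuousOn.of_closed_cover (isClosed_broomSlice.union (isClosed_axis (-2) (-1)))
    (isClosed_Ici_apply_zero (-1)) (H.broomWedge_subset hT) ?_ ?_
  · refine ContinuousOn.mono (ContinuousOn.union_of_isClosed ?_ ?_ isClosed_broomSlice
      (isClosed_axis (-2) (-1))) inter_subset_right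
    · refine ContinuousOn.congr (f := fun p => H.place 0 (H.hairExt 0 (planePart p))) ?_ fun p hp => ?_
      · exact (H.continuous_place 0).comp_continuousOn ((H.continuousOn_hairExt 0).comp
          continuous_planePart.continuousOn fun p hp => hp.2)
      · rw [H.pushTail_of_broom hp.2 hp.1, ← H.hairExt_of_mem 0 hp.2]
    · exact ContinuousOn.congr (H.continuous_centerPath.comp
        (by fun_prop : Continuous fun p : Space => p 0)).continuousOn
        fun p hp => H.pushTail_of_axis hp.1 hp.2
  · refine (continuousOn_shiftUp.mono fun p hp => ?_).congr fun p hp =>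
      H.pushTail_of_wedge hT (H.mem_wedge_of_le hT hp.1 hp.2)
    exact (mem_wedge_bounds hT (H.mem_wedge_of_le hT hp.1 hp.2)).2.1

theorem wedge_first_cases {p : Space} (hp : p ∈ H.wedge T) :
    (p 0 = -1 ∧ Metric.diam H.carrier • planePart p ∈ H.carrier) ∨
      (planePart p = 0 ∧ p 0 ∈ Icc (-1 : ℝ) (-(1 / 2))) ∨ -(1 / 2) ≤ p 0 := by
  rcases le_or_gt (-(1 / 2)) (p 0) with h | h
  · exact Or.inr (Or.inr h)
  rcases hp with ⟨⟨k, hk⟩, hq⟩ | ⟨h0, h1, -⟩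
  · obtain _ | k := k
    · have h0 : p 0 = -1 := by rw [hk]; norm_num
      rw [h0, div_neg, div_one, neg_neg] at hq
      exact Or.inl ⟨h0, hq⟩
    · exfalso
      have : (1 : ℝ) / (((k + 1 : ℕ) : ℝ) + 1) ≤ 1 / 2 :=
        one_div_le_one_div_of_le (by norm_num) (by push_cast; linarith [k.cast_nonneg (α := ℝ)])
      linarith
  · exact Or.inr (Or.inl ⟨h0, h1, h.le⟩)

theorem pullTail_of_first {p : Space} (hp : p 0 = -1) :
    H.pullTail p = slice (-2) (H.collapse 0 (Metric.diam H.carrier • planePart p)) := by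
  rw [pullTail, if_neg (by rw [hp]; norm_num), if_pos hp]

theorem pullTail_of_axis {p : Space} (h : planePart p = 0) (hp : p 0 ∈ Icc (-1 : ℝ) (-(1 / 2))) :
    H.pullTail p = slice (2 * p 0) 0 := by
  rcases eq_or_lt_of_le hp.2 with h1 | h1
  · rw [pullTail, if_pos h1.ge]
    refine space_ext ?_ ?_
    · rw [shiftDown_apply_zero, h1]; norm_num
    · simp [shiftDown, h]
  · rw [pullTail, if_neg (not_le.2 h1)]
    by_cases h2 : p 0 = -1
    · rw [if_pos h2, h, smul_zero, H.collapse_of_mem_shaved (H.disk_subset_shaved 0 (by simp)), h2]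
      norm_num [broomCenter]
    · rw [if_neg h2]

theorem mapsTo_pullTail (hT : IsTail T) : MapsTo H.pullTail (H.wedge T) (H.broomWedge T) := by
  intro p hp
  rcases H.wedge_first_cases hp with h | h | h
  · rw [H.pullTail_of_first h.1]
    exact Or.inr (Or.inl ⟨rfl, by simp⟩)
  · rw [H.pullTail_of_axis h.1 h.2]
    refine Or.inr (Or.inr ⟨by simp, ?_⟩)
    rw [slice_apply_zero]
    constructor <;> linarith [h.2.1, h.2.2]
  · rw [pullTail, if_pos h]
    exact Or.inl (H.shiftDown_mem_wedge hT hp h)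

theorem continuousOn_pullTail : ContinuousOn H.pullTail (H.wedge T) := by
  have hcl : IsClosed {p : Space | p 0 = -1 ∧ Metric.diam H.carrier • planePart p ∈ H.carrier} := by
    have hc : Continuous fun p : Space => Metric.diam H.carrier • planePart p :=
      by fun_prop
    exact (isClosed_eq (f := fun p : Space => p 0) (by fun_prop) continuous_const).inter
      (H.isCompact_carrier.isClosed.preimage hc)
  refine ContinuousOn.of_closed_cover (hcl.union (isClosed_axis (-1) (-(1 / 2))))
    (isClosed_Ici_apply_zero (-(1 / 2)))
    (fun p hp => or_assoc.2 (H.wedge_first_cases hp)) ?_ ?_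
  · refine ContinuousOn.mono (ContinuousOn.union_of_isClosed ?_ ?_ hcl
      (isClosed_axis (-1) (-(1 / 2)))) inter_subset_right
    · refine ContinuousOn.congr (f := fun p => slice (-2) (H.collapse 0
        (Metric.diam H.carrier • planePart p))) ?_ fun p hp => H.pullTail_of_first hp.1
      exact ContinuousOn.slice_const _ (continuous_subtype_val.comp_continuousOn
        ((H.continuousOn_collapse 0).comp
          (show Continuous fun p : Space => Metric.diam H.carrier • planePart p by
            fun_prop).continuousOn fun p hp => hp.2))
    · refine ContinuousOn.congr (f := fun p => slice (2 * p 0) 0) ?_ fun p hp =>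
        H.pullTail_of_axis hp.1 hp.2
      exact (Continuous.slice (by fun_prop) continuous_const).continuousOn
  · exact (continuousOn_shiftDown.mono fun p hp => hp.2).congr fun p hp => if_pos hp.2

/-- The radius of the first disk collapses to the center of the broom, and the axis part is
stretched over the connecting segment. The composite thus preserves this segment, and a
straight-line homotopy stays inside it. -/
theorem pullTail_pushTail_axis {p : Space} (h : planePart p = 0) (hp : p 0 ∈ Icc (-2 : ℝ) (-1)) :
    planePart (H.pullTail (H.pushTail p)) = 0 ∧
      H.pullTail (H.pushTail p) 0 ∈ Icc (-2 : ℝ) (-1) := by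
  rw [H.pushTail_of_axis h hp]
  rcases le_total (p 0) (-3 / 2) with h3 | h3
  · have h1 : max 0 (p 0 + 3 / 2) = 0 := max_eq_left (by linarith)
    have h2 : max 0 (-3 - 2 * p 0) = -3 - 2 * p 0 := max_eq_right (by linarith)
    rw [H.pullTail_of_first (by simp [centerPath, h1])]
    have hc : H.collapse 0 (Metric.diam H.carrier • planePart (H.centerPath (p 0))) = broomCenter := by
      refine H.collapse_of_mem_shaved (H.disk_subset_shaved 0 ?_)
      rw [centerPath, planePart_slice, smul_smul, mul_div_cancel₀ _ H.diam_pos.ne', h2,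
        mem_closedBall_zero_iff, norm_smul, H.norm_m, mul_one, Real.norm_of_nonneg (by linarith)]
      linarith [hp.1]
    rw [hc, planePart_slice, slice_apply_zero]
    exact ⟨rfl, by norm_num⟩
  · have h1 : max 0 (p 0 + 3 / 2) = p 0 + 3 / 2 := max_eq_right (by linarith)
    have h2 : max 0 (-3 - 2 * p 0) = 0 := max_eq_left (by linarith)
    rw [H.pullTail_of_axis]
    · rw [planePart_slice, slice_apply_zero, centerPath, slice_apply_zero, h1]
      exact ⟨rfl, by constructor <;> linarith [hp.2]⟩
    · simp [centerPath, h2]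
    · rw [centerPath, slice_apply_zero, h1]
      constructor <;> linarith [hp.2]

/-- On the wedge the two shifts cancel, and on the broom the collapse inverts the embedding of the
hair. Only the connecting segment has to be moved. -/
theorem homotopyDominated_broomWedge_wedge (hT : IsTail T) :
    HomotopyDominated (H.broomWedge T) (H.wedge T) := by
  refine ⟨ContinuousMap.ofContinuousOn H.pushTail (H.continuousOn_pushTail hT) (H.mapsTo_pushTail hT),
    ContinuousMap.ofContinuousOn H.pullTail (H.continuousOn_pullTail) (H.mapsTo_pullTail hT),
    homotopic_id_of_segment_subset _ ?_⟩
  rintro ⟨p, hp⟩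
  show segment ℝ (H.pullTail (H.pushTail p)) p ⊆ H.broomWedge T
  have key : H.pullTail (H.pushTail p) = p → segment ℝ (H.pullTail (H.pushTail p)) p ⊆
      H.broomWedge T := fun h => by
    rw [h, segment_same]; exact singleton_subset_iff.2 hp
  rcases hp with hp' | hp' | hp'
  · refine key ?_
    have hb := mem_wedge_bounds hT hp'
    rw [H.pushTail_of_wedge hT hp', pullTail, if_pos, shiftDown_shiftUp hb.2.1]
    rw [shiftUp_apply_zero, le_div_iff₀ (by linarith)]
    linarith
  · refine key ?_
    rw [H.pushTail_of_broom hp'.2 hp'.1, H.pullTail_of_first (by norm_num [place_apply_zero]),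
      planePart_place, smul_smul]
    have h1 : Metric.diam H.carrier * (1 / ((((0 : ℕ) : ℝ) + 1) * Metric.diam H.carrier)) = 1 := by
      have := H.diam_pos.ne'
      push_cast
      field_simp
      norm_num
    rw [h1, one_smul, collapse_hair]
    exact space_ext hp'.1.symm (by simp)
  · exact fun z hz => Or.inr (Or.inr ((convex_axis (convex_Icc (-2) (-1))).segment_subset
      (H.pullTail_pushTail_axis hp'.1 hp'.2) hp' hz))

end HairyDisk

/-! ### Dimension of the wedges -/

theorem countable_insert_levels : (insert (-2) (insert 0 levels)).Countable := by
  have : levels = range fun k : ℕ => -(1 / ((k : ℝ) + 1)) := by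
    ext x; simp [levels, eq_comm]
  rw [this]
  exact ((countable_range _).insert _).insert _

namespace HairyDisk

variable (H : HairyDisk) {T : Set ℝ}

/-- Points of the factors and of the additional broom have their first coordinate in the countable
set; points of the axis have their last two coordinates there, because they vanish. -/
theorem ncard_coords_le {p : Space} (hp : p ∈ H.broomWedge T) :
    {i | p i ∉ insert (-2) (insert 0 levels)}.ncard ≤ 2 := by
  have h1 : p 0 ∈ insert (-2) (insert 0 levels) →
      {i | p i ∉ insert (-2) (insert 0 levels)}.ncard ≤ 2 := by
    intro h
    refine (ncard_le_ncard (t := {1, 2}) (fun i hi => ?_) (toFinite _)).trans (ncard_pair (by decide)).le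
    fin_cases i
    · exact absurd h hi
    · simp
    · simp
  have h2 : planePart p = 0 → {i | p i ∉ insert (-2) (insert 0 levels)}.ncard ≤ 2 := by
    intro h
    have e1 : p 1 = 0 := congrArg (fun q : Plane => q 0) h
    have e2 : p 2 = 0 := congrArg (fun q : Plane => q 1) h
    refine (ncard_le_ncard (t := {0}) (fun i hi => ?_) (toFinite _)).trans (by simp)
    fin_cases i
    · simp
    · exact absurd (Or.inr (Or.inl e1)) hi
    · exact absurd (Or.inr (Or.inl e2)) hi
  rcases hp with (h | h) | (h | h)
  · exact h1 (Or.inr (Or.inr h.1))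
  · exact h2 h.1
  · exact h1 (Or.inl h.1)
  · exact h2 h.1

/-- The lower bound comes from the disk of the first factor. Stating the result for all `S` between
the two wedges covers both of them. -/
theorem smallInductiveDimension_eq_two {S : Set Space} (h1 : H.wedge T ⊆ S)
    (h2 : S ⊆ H.broomWedge T) : smallInductiveDimension S = 2 := by
  refine smallInductiveDimension_eq 2 ?_ ?_
  · exact hasSmallInductiveDimensionLE_of_countable_coords 2 _ countable_insert_levels S
      (fun p => WithLp.ofLp p.1)
      ((PiLp.homeomorph 2 _).isInducing.comp IsInducing.subtypeVal)
      fun p => H.ncard_coords_le (h2 p.2)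
  · classical
    have hmem : ∀ z : ℂ, z ∈ Metric.closedBall (0 : ℂ) 1 → (!₂[z.re, z.im] : Plane) ∈ H.carrier := by
      intro z hz
      refine H.disk_subset_carrier ?_
      rw [mem_closedBall_zero_iff] at hz ⊢
      rw [← sq_le_sq₀ (norm_nonneg _) zero_le_one, norm_sq_plane]
      rw [← sq_le_sq₀ (norm_nonneg _) zero_le_one, Complex.sq_norm, Complex.normSq_apply] at hz
      simp only [Matrix.cons_val_zero, Matrix.cons_val_one]
      linarith
    let φ : ℂ → S := fun z => if hz : z ∈ Metric.closedBall (0 : ℂ) 1 then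
      ⟨H.place 0 !₂[z.re, z.im], h1 (H.place_mem_wedge T 0 (hmem z hz))⟩
      else ⟨slice (-1) 0, h1 (by
        have := H.place_mem_wedge T 0 H.zero_mem_carrier
        rwa [place_zero_eq, smul_zero] at this)⟩
    have hφ : ∀ z ∈ Metric.closedBall (0 : ℂ) 1, (φ z : Space) = H.place 0 !₂[z.re, z.im] :=
      fun z hz => by simp only [φ, dif_pos hz]
    refine not_hasSmallInductiveDimensionLT_two φ ?_ ?_
    · rw [IsInducing.subtypeVal.continuousOn_iff]
      refine ContinuousOn.congr (f := fun z : ℂ => H.place 0 !₂[z.re, z.im]) ?_ hφ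
      exact ((H.continuous_place 0).comp (by fun_prop)).continuousOn
    · intro z hz w hw hzw
      have h := congrArg Subtype.val hzw
      rw [hφ z hz, hφ w hw] at h
      have h' := H.place_injective 0 h
      exact Complex.ext (congrArg (fun q : Plane => q 0) h') (congrArg (fun q : Plane => q 1) h')

theorem isTwoDimContinuum_of_subset {S : Set Space} (hS : IsCompact S) (hc : IsPreconnected S)
    (h1 : H.wedge T ⊆ S) (h2 : S ⊆ H.broomWedge T) : IsTwoDimContinuum S := by
  refine ⟨isCompact_iff_compactSpace.1 hS, isConnected_iff_connectedSpace.1 ⟨?_, hc⟩,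
    inferInstance, H.smallInductiveDimension_eq_two h1 h2⟩
  exact ⟨_, h1 (H.place_mem_wedge T 0 H.zero_mem_carrier)⟩

end HairyDisk

/-! ### One-point compactifications and the theorem -/

/-- A compact set is the one-point compactification of the complement of any of its points. -/
theorem nonempty_onePoint_homeomorph {E : Type} [TopologicalSpace E] [T2Space E] {S : Set E} {x : E}
    (hx : x ∉ S) (hS : IsCompact (S ∪ {x})) : Nonempty (OnePoint S ≃ₜ (S ∪ {x} : Set E)) := by
  have : CompactSpace (S ∪ {x} : Set E) := isCompact_iff_compactSpace.1 hS
  refine ⟨OnePoint.equivOfIsEmbeddingOfRangeEq (⟨x, Or.inr rfl⟩ : (S ∪ {x} : Set E))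
    (inclusion subset_union_left) (IsEmbedding.inclusion _) ?_⟩
  ext ⟨y, hy⟩
  rw [range_inclusion]
  constructor
  · intro h h'
    exact hx (by rw [← show y = x from congrArg Subtype.val h']; exact h)
  · intro h
    exact hy.resolve_right fun h' => h (Subtype.ext h')

theorem theorem3p5 :
    Nonempty HairyDisk ∧ ∀ H : HairyDisk,
      (HEqual H.WHo H.WBHo ∧ ¬ HomotopyEquivalent H.WHo H.WBHo) ∧
      (HEqual H.WH H.WBH ∧ ¬ HomotopyEquivalent H.WH H.WBH) ∧
      (Nonempty (OnePoint H.WHo ≃ₜ H.WH) ∧ Nonempty (OnePoint H.WBHo ≃ₜ H.WBH)) ∧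
      (IsTwoDimContinuum H.WH ∧ IsTwoDimContinuum H.WBH) := by
  refine ⟨inferInstance, fun H => ⟨?_, ?_, ⟨?_, ?_⟩, ?_⟩⟩
  · rw [H.WHo_eq, H.WBHo_eq]
    exact ⟨⟨H.homotopyDominated_wedge_broomWedge isTail_Iio,
      H.homotopyDominated_broomWedge_wedge isTail_Iio⟩, H.not_homotopyEquivalent isTail_Iio⟩
  · rw [H.WH_eq, H.WBH_eq]
    exact ⟨⟨H.homotopyDominated_wedge_broomWedge isTail_Iic,
      H.homotopyDominated_broomWedge_wedge isTail_Iic⟩, H.not_homotopyEquivalent isTail_Iic⟩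
  · refine nonempty_onePoint_homeomorph ?_ ?_
    · rw [H.WHo_eq]
      rintro (h | h)
      · exact lt_irrefl _ (levels_mem_Ico h.1).2
      · exact lt_irrefl (0 : ℝ) h.2.2
    · change IsCompact H.WH
      rw [H.WH_eq]; exact H.isCompact_wedge
  · refine nonempty_onePoint_homeomorph ?_ ?_
    · rw [H.WBHo_eq]
      rintro ((h | h) | h)
      · exact lt_irrefl _ (levels_mem_Ico h.1).2
      · exact lt_irrefl (0 : ℝ) h.2.2
      · have := (HairyDisk.broomTail_bounds h).2
        norm_num at this
    · change IsCompact H.WBH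
      rw [H.WBH_eq]; exact H.isCompact_broomWedge
  · rw [H.WH_eq, H.WBH_eq]
    exact ⟨H.isTwoDimContinuum_of_subset H.isCompact_wedge (H.isPreconnected_wedge isTail_Iic)
        Subset.rfl subset_union_left,
      H.isTwoDimContinuum_of_subset H.isCompact_broomWedge (H.isPreconnected_broomWedge isTail_Iic)
        subset_union_left Subset.rfl⟩
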